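/- Let $X$ be a real Hilbert space, $\mathcal A$ a positive self-adjoint operator in $X$ and $\mathcal A^{1/2}$ its positive square root. Let $\tau,\alpha,b,c>0$ and consider $$\tau u_{ttt}+\alpha u_{tt}+c^2\mathcal A u+b\mathcal A u_t-\int_0^t g(t-s)\mathcal A u(s)\,ds=0,\qquad u(0)=u_0,\ u_t(0)=u_1,\ u_{tt}(0)=u_2,\qquad (1)$$ with $(u_0,u_1,u_2)\in D(\mathcal A^{1/2})\times D(\mathcal A^{1/2})\times X$. Assume the following. 1. $g\in C^1([0,\infty))$, $g(t)>0$ for all $t\ge 0$, $g(0)<b\alpha\gamma/\tau^2$ with $\gamma=\alpha-c^2\tau/b$, and $\int_0^\infty g(s)\,ds<c^2$. 2. $H\in C^1([0,\infty))$ is convex and strictly increasing with $H(0)=0$, and $g'(t)+H(g(t))\le 0$ for all $t>0$. 3. $y:[0,\infty)\to[0,\infty)$ solves $y'(t)+H(y(t))=0$, $y(0)=g(0)$, and $\int_0^\infty y(t)^{1-\alpha_0}\,dt<\infty$ for some $\alpha_0\in(0,1)$. 4. There is $\bar\delta>0$ such that $H\in C^2(0,\bar\delta)$ and $x^2H''(x)-xH'(x)+H(x)\ge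 0$ for all $x\in(0,\bar\delta)$. 5. There is $\lambda_0$ such that $\|x\|\le\lambda_0\|\mathcal A^{1/2}x\|$ for all $x\in D(\mathcal A^{1/2})$. 6. $\gamma>0$. Let $u\in C^1([0,\infty);D(\mathcal A^{1/2}))\cap C^2([0,\infty);X)$ be a weak solution of (1), that is, $u$ has the given initial data and for all $\varphi\in D(\mathcal A^{1/2})$ and $t\ge 0$ $$\frac{d}{dt}\,\tau(u_{tt},\varphi)+\alpha(u_{tt},\varphi)+c^2(\mathcal A^{1/2}u,\mathcal A^{1/2}\varphi)+b(\mathcal A^{1/2}u_t,\mathcal A^{1/2}\varphi)-\int_0^t g(t-s)(\mathcal A^{1/2}u(s),\mathcal A^{1/2}\varphi)\,ds=0 .$$ For $k\in(c^2/b,\alpha/\tau)$ let $E(t)=E_1(t)+kE_2(t)$ be its energy, where $$E_1(t)=\tau\|u_{tt}\|^2+b\|\mathcal A^{1/2}u_t\|^2+2c^2(\mathcal A^{1/2}u,\mathcal A^{1/2}u_t)-2\int_0^t g(t-s)(\mathcal A^{1/2}u(s),\mathcal A^{1/2}u_t(t))\,ds,$$ $$E_2(t)=c^2\|\mathcal A^{1/2}u\|^2+\alpha\|u_t\|^2+2\tau(u_{tt},u_t)+\int_0^t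 g(t-s)\|\mathcal A^{1/2}u(t)-\mathcal A^{1/2}u(s)\|^2\,ds-\Big(\int_0^t g(s)\,ds\Big)\|\mathcal A^{1/2}u\|^2 .$$ Then, for every such $k$, $E(t)\to 0$ as $t\to\infty$, and there are constants $\tilde C,\tilde\beta,\tilde\kappa>0$ such that $$E(t)\le\tilde C\,y(\tilde\beta t+\tilde\kappa)\qquad\text{for all }t\ge 0.$$ -/

import Mathlib

open Set Filter Topology MeasureTheory
open scoped InnerProductSpace

namespace MGT

variable {X : Type*} [NormedAddCommGroup X] [InnerProductSpace ℝ X] [CompleteSpace X]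

/-- A (possibly unbounded) linear operator on a real Hilbert space is positive self-adjoint:
it equals its adjoint (in particular it is densely defined) and its quadratic form is
nonnegative. -/
structure IsPositiveSelfAdjoint (A : X →ₗ.[ℝ] X) : Prop where
  selfAdjoint : IsSelfAdjoint A
  nonneg : ∀ x : A.domain, 0 ≤ ⟪A x, (x : X)⟫_ℝ

/-- `S` is the positive square root `A^{1/2}` of `A`: `S` is positive self-adjoint and `S ∘ S = A`,
where `S ∘ S` has its natural domain `{x ∈ D(S) : S x ∈ D(S)}`. -/
structure IsPositiveSqrt (S A : X →ₗ.[ℝ] X) : Prop where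
  positive : IsPositiveSelfAdjoint S
  sq : ∀ x y : X, (x, y) ∈ A.graph ↔ ∃ z : X, (x, z) ∈ S.graph ∧ (z, y) ∈ S.graph

/-- Weak solutions on `[0, ∞)` of
`τ u_ttt + α u_tt + c² A u + b A u_t - ∫₀ᵗ g(t-s) A u(s) ds = 0`,
`u(0) = u₀`, `u_t(0) = u₁`, `u_tt(0) = u₂`, where `S = A^{1/2}`.
The functions `v` and `w` are the time derivatives `u_t` and `u_tt`. The regularity is
`u ∈ C¹([0,∞); D(S)) ∩ C²([0,∞); X)` with the graph norm on `D(S)`, and the equation holds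
when tested against every element of `D(S)`. -/
structure IsWeakSolution (S : X →ₗ.[ℝ] X) (τ α c b : ℝ) (g : ℝ → ℝ)
    (u₀ u₁ : S.domain) (u₂ : X) (u v : ℝ → S.domain) (w : ℝ → X) : Prop where
  hasDeriv_u : ∀ t, 0 ≤ t →
    HasDerivWithinAt (fun s => (u s : X)) (v t : X) (Ici 0) t
  hasDeriv_Su : ∀ t, 0 ≤ t →
    HasDerivWithinAt (fun s => S (u s)) (S (v t)) (Ici 0) t
  continuous_Sv : ContinuousOn (fun t => S (v t)) (Ici 0)
  hasDeriv_v : ∀ t, 0 ≤ t →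
    HasDerivWithinAt (fun s => (v s : X)) (w t) (Ici 0) t
  continuous_w : ContinuousOn w (Ici 0)
  init_u : u 0 = u₀
  init_v : v 0 = u₁
  init_w : w 0 = u₂
  equation : ∀ φ : S.domain, ∀ t, 0 ≤ t →
    HasDerivWithinAt (fun s => τ * ⟪w s, (φ : X)⟫_ℝ)
      (-(α * ⟪w t, (φ : X)⟫_ℝ + c ^ 2 * ⟪S (u t), S φ⟫_ℝ + b * ⟪S (v t), S φ⟫_ℝ
        - ∫ s in (0 : ℝ)..t, g (t - s) * ⟪S (u s), S φ⟫_ℝ)) (Ici 0) t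

/-- `(g ∘ h)(t) = ∫₀ᵗ g(t-s) ‖h(t) - h(s)‖² ds`. -/
noncomputable def memoryQuad (g : ℝ → ℝ) (h : ℝ → X) (t : ℝ) : ℝ :=
  ∫ s in (0 : ℝ)..t, g (t - s) * ‖h t - h s‖ ^ 2

/-- `E₁ = τ‖u_tt‖² + b‖A^{1/2}u_t‖² + 2c²(Au, u_t) - 2∫₀ᵗ g(t-s)(Au(s), u_t(t)) ds`. -/
noncomputable def energy₁ (S : X →ₗ.[ℝ] X) (τ c b : ℝ) (g : ℝ → ℝ)
    (u v : ℝ → S.domain) (w : ℝ → X) (t : ℝ) : ℝ :=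
  τ * ‖w t‖ ^ 2 + b * ‖S (v t)‖ ^ 2 + 2 * c ^ 2 * ⟪S (u t), S (v t)⟫_ℝ
    - 2 * ∫ s in (0 : ℝ)..t, g (t - s) * ⟪S (u s), S (v t)⟫_ℝ

/-- `E₂ = c²‖A^{1/2}u‖² + α‖u_t‖² + 2τ(u_tt, u_t) + g ∘ A^{1/2}u - (∫₀ᵗ g)‖A^{1/2}u‖²`. -/
noncomputable def energy₂ (S : X →ₗ.[ℝ] X) (τ α c : ℝ) (g : ℝ → ℝ)
    (u v : ℝ → S.domain) (w : ℝ → X) (t : ℝ) : ℝ :=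
  c ^ 2 * ‖S (u t)‖ ^ 2 + α * ‖(v t : X)‖ ^ 2 + 2 * τ * ⟪w t, (v t : X)⟫_ℝ
    + memoryQuad g (fun s => S (u s)) t - (∫ s in (0 : ℝ)..t, g s) * ‖S (u t)‖ ^ 2

/-- The natural energy `E = E₁ + k E₂`. -/
noncomputable def energy (S : X →ₗ.[ℝ] X) (τ α c b : ℝ) (g : ℝ → ℝ) (k : ℝ)
    (u v : ℝ → S.domain) (w : ℝ → X) (t : ℝ) : ℝ :=
  energy₁ S τ c b g u v w t + k * energy₂ S τ α c g u v w t

end MGT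

/-! Every energy with `k` in the given interval is equivalent to the phase-space norm `phaseNorm`,
so one well-chosen parameter suffices. Near `α / τ` the bound on `g 0` gives `g 0 < k * (k * b - c ^
2)` (`exists_dissipative_parameter`). For such a `k` the energy `F` dissipates `‖u_tt‖²`, `‖S u_t‖²`
and the memory term with kernel `-g'` (`deriv_extEnergy_le`). Since `u_tt` need not lie in `D(S)`,
the identity behind this is obtained by testing with difference quotients of `u_t` and passing to
the limit (`integral_energy_identity`).

Adding `τ (u_tt, u)` to a multiple of `F` recovers the missing `‖S u‖²` and gives `L' ≤ -a F + C G`,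
with `G` the memory term of kernel `g` (`exists_lyapunov`). The loss in `G` can be made small
because `g ^ 2 ≤ p * (g + C * -g')` with `p` of arbitrarily small mass (`exists_small_weight`). A
tail functional then absorbs `G` in time average, so `F` has bounded integral. As `F` is
nonincreasing, `t * F t` is bounded, which already gives decay to zero.

For the rate, convexity yields `H x / x * z ≤ H x + H z`. Applied with `z = g (t - s)` and `H ∘ g ≤
-g'`, it bounds `H x / x * G` by a constant times `H x` plus the dissipated memory; the constant is
finite because `F` has bounded integral. Taking `x = Y t = y (β t + 1)` turns the Lyapunov
inequality into a linear one whose coefficient is `H (Y) / Y`, and a multiple of `Y` is a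
supersolution of it (`exists_decay_of_lyapunov`). Hence the rate holds with the same `H`, without
iteration. -/

namespace MGT

/-! ### Extension across `t = 0` and differentiation of convolutions. -/

section Calculus

variable {E : Type*} [NormedAddCommGroup E] [NormedSpace ℝ E]

/-- A function continuous on `[0, ∞)`, extended to `ℝ` by its value at `0`, is continuous. -/
theorem continuous_comp_max_zero {F : Type*} [TopologicalSpace F] {f : ℝ → F}
    (hf : ContinuousOn f (Ici 0)) : Continuous fun t => f (max t 0) :=
  hf.comp_continuous (by fun_prop) fun t => le_max_right t 0

/-- A `C¹` function on `[0, ∞)` extends to a `C¹` function on `ℝ` with constant derivative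
on `(-∞, 0]`. -/
theorem exists_C1_extension [CompleteSpace E] {f f' : ℝ → E}
    (hf : ∀ t, 0 ≤ t → HasDerivWithinAt f (f' t) (Ici 0) t) (hf' : ContinuousOn f' (Ici 0)) :
    ∃ F : ℝ → E, (∀ t, HasDerivAt F (f' (max t 0)) t) ∧ ∀ t, 0 ≤ t → F t = f t := by
  have hc := continuous_comp_max_zero hf'
  refine ⟨fun t => f 0 + ∫ s in (0 : ℝ)..t, f' (max s 0), fun t => ?_, fun t ht => ?_⟩
  · exact (intervalIntegral.integral_hasDerivAt_right (hc.intervalIntegrable _ _)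
      (hc.stronglyMeasurableAtFilter _ _) hc.continuousAt).const_add _
  · have h1 : ∫ s in (0 : ℝ)..t, f' (max s 0) = f t - f 0 := by
      refine intervalIntegral.integral_eq_sub_of_hasDerivAt_of_le ht
        (fun s hs => ((hf s hs.1).continuousWithinAt).mono Icc_subset_Ici_self)
        (fun s hs => ?_) (hc.intervalIntegrable _ _)
      rw [max_eq_left hs.1.le]
      exact (hf s hs.1.le).hasDerivAt (Ici_mem_nhds hs.1)
    simp [h1]

/-- The convolution `(p * f)(t) = ∫₀ᵗ p(t - s) f(s) ds`. -/
noncomputable def conv (p : ℝ → ℝ) (f : ℝ → E) (t : ℝ) : E :=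
  ∫ s in (0 : ℝ)..t, p (t - s) • f s

theorem continuous_conv {p : ℝ → ℝ} {f : ℝ → E} (hp : Continuous p) (hf : Continuous f) :
    Continuous (conv p f) := by
  unfold conv
  exact intervalIntegral.continuous_parametric_intervalIntegral_of_continuous
    (f := fun t s => p (t - s) • f s) (by fun_prop) continuous_id

/-- The upper limit and the argument of the kernel are separated into two variables. Both partial
derivatives are jointly continuous, so the chain rule along the diagonal applies; `f` need only be
continuous. -/
theorem hasDerivAt_conv [CompleteSpace E] {p p' : ℝ → ℝ} {f : ℝ → E}
    (hp : ∀ t, HasDerivAt p (p' t) t) (hp' : Continuous p') (hf : Continuous f) (t : ℝ) :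
    HasDerivAt (conv p f) (p 0 • f t + conv p' f t) t := by
  have hpc : Continuous p := continuous_iff_continuousAt.2 fun t => (hp t).continuousAt
  let Φ : ℝ → ℝ → E := fun a b => ∫ s in (0 : ℝ)..a, p (b - s) • f s
  let Φ₁ : ℝ → ℝ → E := fun a b => p (b - a) • f a
  let Φ₂ : ℝ → ℝ → E := fun a b => ∫ s in (0 : ℝ)..a, p' (b - s) • f s
  have d₁ : ∀ a b, HasDerivAt (fun a => Φ a b) (Φ₁ a b) a := fun a b => by
    have hc : Continuous fun s => p (b - s) • f s := by fun_prop
    exact intervalIntegral.integral_hasDerivAt_right (hc.intervalIntegrable _ _)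
      (hc.stronglyMeasurableAtFilter _ _) hc.continuousAt
  have d₂ : ∀ a b, HasDerivAt (fun b => Φ a b) (Φ₂ a b) b := fun a b => by
    have hcomp : IsCompact ((Icc (b - 1) (b + 1)) ×ˢ (uIcc 0 a)) :=
      isCompact_Icc.prod isCompact_uIcc
    obtain ⟨C, hC⟩ := hcomp.exists_bound_of_continuousOn
      (f := fun z : ℝ × ℝ => p' (z.1 - z.2) • f z.2) (by fun_prop)
    refine (intervalIntegral.hasDerivAt_integral_of_dominated_loc_of_deriv_le
      (F := fun b s => p (b - s) • f s) (F' := fun b s => p' (b - s) • f s)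
      (bound := fun _ => C) (s := Icc (b - 1) (b + 1))
      (Icc_mem_nhds (by linarith) (by linarith)) ?_ ?_ ?_ ?_ ?_ ?_).2
    · exact Eventually.of_forall fun x =>
        (show Continuous fun s => p (x - s) • f s by fun_prop).aestronglyMeasurable
    · exact (show Continuous fun s => p (b - s) • f s by fun_prop).intervalIntegrable _ _
    · exact (show Continuous fun s => p' (b - s) • f s by fun_prop).aestronglyMeasurable
    · exact Eventually.of_forall fun s hs x hx => hC (x, s) ⟨hx, uIoc_subset_uIcc hs⟩
    · exact intervalIntegrable_const
    · refine Eventually.of_forall fun s _ x _ => ?_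
      have := (hp (x - s)).comp x ((hasDerivAt_id x).sub_const s)
      simpa using! this.smul_const (f s)
  have c₁ : Continuous fun z : ℝ × ℝ => Φ₁ z.1 z.2 := by
    simp only [Φ₁]; fun_prop
  have c₂ : Continuous fun z : ℝ × ℝ => Φ₂ z.1 z.2 :=
    intervalIntegral.continuous_parametric_intervalIntegral_of_continuous
      (f := fun (z : ℝ × ℝ) s => p' (z.2 - s) • f s) (by fun_prop) continuous_fst
  have key := hasStrictFDerivAt_uncurry_coprod (𝕜 := ℝ) (u := (t, t)) (f := Φ)
    (f₁ := fun a b => ContinuousLinearMap.toSpanSingleton ℝ (Φ₁ a b))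
    (f₂ := fun a b => ContinuousLinearMap.toSpanSingleton ℝ (Φ₂ a b))
    (Eventually.of_forall fun z => (d₁ z.1 z.2).hasFDerivAt)
    (Eventually.of_forall fun z => (d₂ z.1 z.2).hasFDerivAt)
    ((ContinuousLinearMap.toSpanSingletonCLE (𝕜 := ℝ) (E := E)).continuous.comp c₁).continuousAt
    ((ContinuousLinearMap.toSpanSingletonCLE (𝕜 := ℝ) (E := E)).continuous.comp c₂).continuousAt
  have := key.hasFDerivAt.comp_hasDerivAt (f := fun x : ℝ => (x, x)) t
    ((hasDerivAt_id t).prodMk (hasDerivAt_id t))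
  have h2 : HasDerivAt (conv p f) _ t := this
  convert h2 using 1
  simp [Function.HasUncurry.uncurry, Φ₁, Φ₂, conv]

end Calculus

/-! ### Memory integrals expressed through convolutions. -/

section Memory

variable {X : Type*} [NormedAddCommGroup X] [InnerProductSpace ℝ X]

theorem integral_comp_reflect (p : ℝ → ℝ) (t : ℝ) :
    ∫ s in (0 : ℝ)..t, p (t - s) = ∫ s in (0 : ℝ)..t, p s := by
  simp [intervalIntegral.integral_comp_sub_left p t]

theorem integral_conv_inner [CompleteSpace X] {p : ℝ → ℝ} {U : ℝ → X} (hp : Continuous p)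
    (hU : Continuous U) (t : ℝ) (x : X) :
    ∫ s in (0 : ℝ)..t, p (t - s) * ⟪U s, x⟫_ℝ = ⟪conv p U t, x⟫_ℝ := by
  have h := (innerSL ℝ x).intervalIntegral_comp_comm (μ := volume) (a := 0) (b := t)
    (f := fun s => p (t - s) • U s)
    ((show Continuous fun s => p (t - s) • U s by fun_prop).intervalIntegrable _ _)
  simp only [innerSL_apply_apply] at h
  rw [real_inner_comm, conv, ← h]
  simp [inner_smul_right, real_inner_comm]

/-- `∫₀ᵗ p(t-s) (U(t) - U(s), x) ds` in terms of convolutions. -/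
theorem integral_conv_inner_sub [CompleteSpace X] {p : ℝ → ℝ} {U : ℝ → X} (hp : Continuous p)
    (hU : Continuous U) (t : ℝ) (x : X) :
    ∫ s in (0 : ℝ)..t, p (t - s) * ⟪U t - U s, x⟫_ℝ
      = (∫ s in (0 : ℝ)..t, p s) * ⟪U t, x⟫_ℝ - ⟪conv p U t, x⟫_ℝ := by
  rw [← integral_conv_inner hp hU, ← integral_comp_reflect p t, ← intervalIntegral.integral_mul_const,
    ← intervalIntegral.integral_sub]
  · simp only [inner_sub_left, mul_sub]
  · exact (show Continuous fun s => p (t - s) * ⟪U t, x⟫_ℝ by fun_prop).intervalIntegrable _ _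
  · exact (show Continuous fun s => p (t - s) * ⟪U s, x⟫_ℝ by fun_prop).intervalIntegrable _ _

/-- Expanding the square isolates the dependence on `U t`, leaving pieces covered by the convolution
derivative. -/
theorem memoryQuad_eq [CompleteSpace X] {p : ℝ → ℝ} {U : ℝ → X} (hp : Continuous p)
    (hU : Continuous U) (t : ℝ) :
    memoryQuad p U t = (∫ s in (0 : ℝ)..t, p s) * ‖U t‖ ^ 2 - 2 * ⟪conv p U t, U t⟫_ℝ
      + conv p (fun s => ‖U s‖ ^ 2) t := by
  rw [← integral_conv_inner hp hU, ← integral_comp_reflect p t, memoryQuad, conv,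
    ← intervalIntegral.integral_mul_const, ← intervalIntegral.integral_const_mul,
    ← intervalIntegral.integral_sub, ← intervalIntegral.integral_add]
  · simp only [norm_sub_sq_real, real_inner_comm, smul_eq_mul]
    congr 1
    ext s
    ring
  · exact Continuous.intervalIntegrable (by fun_prop) _ _
  · exact Continuous.intervalIntegrable (by fun_prop) _ _
  · exact Continuous.intervalIntegrable (by fun_prop) _ _
  · exact Continuous.intervalIntegrable (by fun_prop) _ _

end Memory

end MGT

namespace MGT

/-! ### Difference quotients and their limits under the integral. -/

section DifferenceQuotients

variable {X : Type*} [NormedAddCommGroup X] [InnerProductSpace ℝ X]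

/-- The forward difference `f(t + h) - f(t)` divided by `h`. -/
noncomputable def diffQuot (h : ℝ) (f : ℝ → X) (t : ℝ) : X := h⁻¹ • (f (t + h) - f t)

theorem HasDerivAt.diffQuot {f : ℝ → X} {f' : ℝ → X} {h t : ℝ} (h₁ : HasDerivAt f (f' t) t)
    (h₂ : HasDerivAt f (f' (t + h)) (t + h)) :
    HasDerivAt (MGT.diffQuot h f) (MGT.diffQuot h f' t) t :=
  ((h₂.comp_add_const t h).sub h₁).const_smul h⁻¹

theorem continuous_diffQuot {f : ℝ → X} (hf : Continuous f) (h : ℝ) :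
    Continuous (diffQuot h f) := by
  unfold diffQuot; fun_prop

theorem tendsto_diffQuot {f : ℝ → X} {f' : X} {t : ℝ} (hf : HasDerivAt f f' t) :
    Tendsto (fun h => diffQuot h f t) (𝓝[>] 0) (𝓝 f') :=
  hf.tendsto_slope_zero_right

theorem exists_bound_diffQuot {f f' : ℝ → X} (hf : ∀ t, HasDerivAt f (f' t) t)
    (hf' : Continuous f') (T : ℝ) :
    ∃ C, ∀ h ∈ Ioo (0 : ℝ) 1, ∀ t ∈ Icc 0 T, ‖diffQuot h f t‖ ≤ C := by
  obtain ⟨C, hC⟩ := (isCompact_Icc (a := (0 : ℝ)) (b := T + 1)).exists_bound_of_continuousOn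
    hf'.continuousOn
  refine ⟨C, fun h hh t ht => ?_⟩
  have := (convex_Icc (0 : ℝ) (T + 1)).norm_image_sub_le_of_norm_hasDerivWithin_le
    (fun x _ => (hf x).hasDerivWithinAt) hC (x := t) (y := t + h)
    ⟨ht.1, by linarith [ht.2]⟩ ⟨by linarith [ht.1, hh.1], by linarith [ht.2, hh.2]⟩
  rw [diffQuot, norm_smul, norm_inv, Real.norm_of_nonneg hh.1.le, inv_mul_le_iff₀ hh.1]
  simpa [abs_of_pos hh.1, mul_comm] using this

/-- Dominated convergence: the mean value inequality bounds both quotients uniformly for `0 < h <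
1`. -/
theorem tendsto_integral_inner_diffQuot {f f' k k' : ℝ → X} (hf : ∀ t, HasDerivAt f (f' t) t)
    (hf' : Continuous f') (hk : ∀ t, HasDerivAt k (k' t) t) (hk' : Continuous k') {T : ℝ}
    (hT : 0 ≤ T) :
    Tendsto (fun h => ∫ t in (0 : ℝ)..T, ⟪diffQuot h f t, diffQuot h k t⟫_ℝ) (𝓝[>] 0)
      (𝓝 (∫ t in (0 : ℝ)..T, ⟪f' t, k' t⟫_ℝ)) := by
  obtain ⟨C, hC⟩ := exists_bound_diffQuot hf hf' T
  obtain ⟨K, hK⟩ := exists_bound_diffQuot hk hk' T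
  have hfc : Continuous f := continuous_iff_continuousAt.2 fun t => (hf t).continuousAt
  have hkc : Continuous k := continuous_iff_continuousAt.2 fun t => (hk t).continuousAt
  refine intervalIntegral.tendsto_integral_filter_of_dominated_convergence (fun _ => C * K)
    (Eventually.of_forall fun h => ((continuous_diffQuot hfc h).inner
      (continuous_diffQuot hkc h)).aestronglyMeasurable) ?_ intervalIntegrable_const
    (Eventually.of_forall fun t _ => (tendsto_diffQuot (hf t)).inner (tendsto_diffQuot (hk t)))
  filter_upwards [Ioo_mem_nhdsGT (zero_lt_one (α := ℝ))] with h hh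
  refine Eventually.of_forall fun t ht => ?_
  rw [uIoc_of_le hT] at ht
  have h1 := hC h hh t (Ioc_subset_Icc_self ht)
  exact (norm_inner_le_norm _ _).trans (mul_le_mul h1 (hK h hh t (Ioc_subset_Icc_self ht))
    (norm_nonneg _) ((norm_nonneg _).trans h1))

end DifferenceQuotients

/-! ### The energy identity for weak solutions. -/

section Identity

variable {X : Type*} [NormedAddCommGroup X] [InnerProductSpace ℝ X]

/-- Data of a weak solution extended from `[0, ∞)` to `ℝ`: `x`, `z`, `w` extend `u`, `u_t`, `u_tt`,
and `U`, `V` extend `A^{1/2} u`, `A^{1/2} u_t`. -/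
structure ExtendedSolution (S : X →ₗ.[ℝ] X) (τ α c b : ℝ) (g : ℝ → ℝ)
    (u v : ℝ → S.domain) (x z w U V : ℝ → X) : Prop where
  eq_u : ∀ t, 0 ≤ t → x t = u t
  eq_v : ∀ t, 0 ≤ t → z t = v t
  eq_U : ∀ t, 0 ≤ t → U t = S (u t)
  eq_V : ∀ t, 0 ≤ t → V t = S (v t)
  continuous_x : Continuous x
  continuous_w : Continuous w
  continuous_V : Continuous V
  hasDeriv_x : ∀ t, 0 < t → HasDerivAt x (z t) t
  hasDeriv_z : ∀ t, HasDerivAt z (w t) t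
  hasDeriv_U : ∀ t, HasDerivAt U (V t) t
  equation : ∀ φ : S.domain, ∀ t, 0 < t →
    HasDerivAt (fun s => τ * ⟪w s, (φ : X)⟫_ℝ)
      (-(α * ⟪w t, (φ : X)⟫_ℝ + c ^ 2 * ⟪U t, S φ⟫_ℝ + b * ⟪V t, S φ⟫_ℝ - ⟪conv g U t, S φ⟫_ℝ)) t

namespace ExtendedSolution

variable {S : X →ₗ.[ℝ] X} {τ α c b : ℝ} {g : ℝ → ℝ} {u v : ℝ → S.domain} {x z w U V : ℝ → X}

theorem continuous_z (hs : ExtendedSolution S τ α c b g u v x z w U V) : Continuous z :=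
  continuous_iff_continuousAt.2 fun t => (hs.hasDeriv_z t).continuousAt

theorem continuous_U (hs : ExtendedSolution S τ α c b g u v x z w U V) : Continuous U :=
  continuous_iff_continuousAt.2 fun t => (hs.hasDeriv_U t).continuousAt

/-- The weak equation tested with a moving, differentiable test function. -/
theorem hasDerivAt_inner (hs : ExtendedSolution S τ α c b g u v x z w U V)
    {p : ℝ → X} {p' : X} {t : ℝ} (ht : 0 < t) (φ : S.domain) (hp : HasDerivAt p p' t)
    (hφ : p t = φ) :
    HasDerivAt (fun s => τ * ⟪w s, p s⟫_ℝ)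
      (τ * ⟪w t, p'⟫_ℝ -
        (α * ⟪w t, p t⟫_ℝ + c ^ 2 * ⟪U t, S φ⟫_ℝ + b * ⟪V t, S φ⟫_ℝ - ⟪conv g U t, S φ⟫_ℝ)) t := by
  have h1 := hs.equation φ t ht
  -- The second factor vanishes at `s = t`, so continuity of `w` is enough; `w` itself need not be
  -- differentiable in norm.
  have h2 : HasDerivAt (fun s => τ * ⟪w s, p s - p t⟫_ℝ) (τ * ⟪w t, p'⟫_ℝ) t := by
    rw [hasDerivAt_iff_tendsto_slope] at hp ⊢
    have h3 := ((hs.continuous_w.tendsto t).mono_left nhdsWithin_le_nhds).inner (𝕜 := ℝ) hp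
    refine (h3.const_mul τ).congr fun s => ?_
    simp only [slope, vsub_eq_sub, smul_eq_mul, inner_smul_right, sub_self, inner_zero_right]
    ring
  rw [← hφ] at h1
  refine ((h2.add h1).congr_deriv (by ring)).congr_of_eventuallyEq (Eventually.of_forall fun s => ?_)
  simp only [Pi.add_apply, inner_sub_right]
  ring

/-- Integrating the equation in time, with the test vector fixed, gives a conserved quantity. In
this form the vector may be chosen afterwards, depending on both endpoints. -/
theorem increment_eq_zero (hs : ExtendedSolution S τ α c b g u v x z w U V) {q : ℝ → X}
    (hq : ∀ t, HasDerivAt q (c ^ 2 • U t - conv g U t) t) (φ : S.domain) {s t : ℝ}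
    (h0 : 0 < s) (hst : s ≤ t) :
    τ * ⟪w t - w s, (φ : X)⟫_ℝ + α * ⟪z t - z s, (φ : X)⟫_ℝ + b * ⟪U t - U s, S φ⟫_ℝ
      + ⟪q t - q s, S φ⟫_ℝ = 0 := by
  let f : ℝ → ℝ := fun r => τ * ⟪w r, (φ : X)⟫_ℝ + α * ⟪z r, (φ : X)⟫_ℝ + b * ⟪U r, S φ⟫_ℝ
      + ⟪q r, S φ⟫_ℝ
  have hf : ∀ r, 0 < r → HasDerivAt f 0 r := fun r hr => by
    have h1 := (((hs.equation φ r hr).add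
      (((hs.hasDeriv_z r).inner ℝ (hasDerivAt_const r (φ : X))).const_mul α)).add
      (((hs.hasDeriv_U r).inner ℝ (hasDerivAt_const r (S φ))).const_mul b)).add
      ((hq r).inner ℝ (hasDerivAt_const r (S φ)))
    refine h1.congr_deriv ?_
    simp only [inner_zero_right, inner_sub_left, inner_smul_left, zero_add,
      RCLike.conj_to_real]
    ring
  have h2 : f t = f s := by
    refine constant_of_has_deriv_right_zero (a := s) (b := t)
      (fun r hr => (hf r (h0.trans_le hr.1)).continuousAt.continuousWithinAt)
      (fun r hr => (hf r (h0.trans_le hr.1)).hasDerivWithinAt) t ⟨hst, le_rfl⟩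
  simp only [f] at h2
  simp only [inner_sub_left]
  linarith

/-- The difference quotient version of the energy identity obtained by testing with `u_tt`. -/
theorem integral_diffQuot (hs : ExtendedSolution S τ α c b g u v x z w U V) {q Q Q' : ℝ → X}
    (hQdef : ∀ t, Q t = c ^ 2 • U t - conv g U t)
    (hq : ∀ t, HasDerivAt q (Q t) t) (hQ : ∀ t, HasDerivAt Q (Q' t) t)
    {T h : ℝ} (hT : 0 ≤ T) (hh : 0 < h) :
    ∫ t in (0 : ℝ)..T, (-α * ⟪diffQuot h z t, diffQuot h z t⟫_ℝ
        + ⟪diffQuot h Q t, diffQuot h U t⟫_ℝ)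
      = (τ / 2 * ‖diffQuot h z T‖ ^ 2 + b / 2 * ‖diffQuot h U T‖ ^ 2
          + ⟪diffQuot h q T, diffQuot h U T⟫_ℝ)
        - (τ / 2 * ‖diffQuot h z 0‖ ^ 2 + b / 2 * ‖diffQuot h U 0‖ ^ 2
          + ⟪diffQuot h q 0, diffQuot h U 0⟫_ℝ) := by
  have hQc : Continuous Q := continuous_iff_continuousAt.2 fun t => (hQ t).continuousAt
  have hqc : Continuous q := continuous_iff_continuousAt.2 fun t => (hq t).continuousAt
  have cz := continuous_diffQuot hs.continuous_z h
  have cU := continuous_diffQuot hs.continuous_U h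
  have cQ := continuous_diffQuot hQc h
  have cq := continuous_diffQuot hqc h
  refine intervalIntegral.integral_eq_sub_of_hasDerivAt_of_le
    (f := fun t => τ / 2 * ‖diffQuot h z t‖ ^ 2 + b / 2 * ‖diffQuot h U t‖ ^ 2
      + ⟪diffQuot h q t, diffQuot h U t⟫_ℝ) hT (by fun_prop) (fun t ht => ?_)
    (Continuous.intervalIntegrable (by fun_prop) _ _)
  have dz := HasDerivAt.diffQuot (hs.hasDeriv_z t) (hs.hasDeriv_z (t + h))
  have dU := HasDerivAt.diffQuot (hs.hasDeriv_U t) (hs.hasDeriv_U (t + h))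
  have dq := HasDerivAt.diffQuot (hq t) (hq (t + h))
  refine (((dz.norm_sq.const_mul (τ / 2)).add (dU.norm_sq.const_mul (b / 2))).add
    (dq.inner ℝ dU)).congr_deriv ?_
  -- The admissible substitute for `u_tt`: an increment of `u_t` stays in `D(S)`.
  have key := hs.increment_eq_zero (fun t => hQdef t ▸ hq t) (v (t + h) - v t) ht.1
    (le_add_of_nonneg_right hh.le)
  rw [LinearPMap.map_sub, AddSubgroupClass.coe_sub, ← hs.eq_v _ ht.1.le,
    ← hs.eq_v _ (add_nonneg ht.1.le hh.le), ← hs.eq_V _ ht.1.le,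
    ← hs.eq_V _ (add_nonneg ht.1.le hh.le)] at key
  simp only [diffQuot, inner_smul_left, inner_smul_right, RCLike.conj_to_real]
  rw [real_inner_comm (w (t + h) - w t)]
  linear_combination (h⁻¹ * h⁻¹) * key

/-- The energy identity obtained by formally testing with `u_tt`. -/
theorem integral_energy_identity [CompleteSpace X] (hs : ExtendedSolution S τ α c b g u v x z w U V)
    {Q Q' : ℝ → X} (hQdef : ∀ t, Q t = c ^ 2 • U t - conv g U t)
    (hQ : ∀ t, HasDerivAt Q (Q' t) t) (hQ' : Continuous Q') {T : ℝ} (hT : 0 ≤ T) :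
    ∫ t in (0 : ℝ)..T, (-α * ‖w t‖ ^ 2 + ⟪Q' t, V t⟫_ℝ)
      = (τ / 2 * ‖w T‖ ^ 2 + b / 2 * ‖V T‖ ^ 2 + ⟪Q T, V T⟫_ℝ)
        - (τ / 2 * ‖w 0‖ ^ 2 + b / 2 * ‖V 0‖ ^ 2 + ⟪Q 0, V 0⟫_ℝ) := by
  have hQc : Continuous Q := continuous_iff_continuousAt.2 fun t => (hQ t).continuousAt
  have hq : ∀ t, HasDerivAt (fun t => ∫ s in (0 : ℝ)..t, Q s) (Q t) t := fun t =>
    intervalIntegral.integral_hasDerivAt_right (hQc.intervalIntegrable _ _)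
      (hQc.stronglyMeasurableAtFilter _ _) hQc.continuousAt
  have hlim : ∀ t, Tendsto (fun h => τ / 2 * ‖diffQuot h z t‖ ^ 2 + b / 2 * ‖diffQuot h U t‖ ^ 2
          + ⟪diffQuot h (fun t => ∫ s in (0 : ℝ)..t, Q s) t, diffQuot h U t⟫_ℝ) (𝓝[>] 0)
      (𝓝 (τ / 2 * ‖w t‖ ^ 2 + b / 2 * ‖V t‖ ^ 2 + ⟪Q t, V t⟫_ℝ)) := fun t =>
    ((((tendsto_diffQuot (hs.hasDeriv_z t)).norm.pow 2).const_mul _).add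
      (((tendsto_diffQuot (hs.hasDeriv_U t)).norm.pow 2).const_mul _)).add
      ((tendsto_diffQuot (hq t)).inner (tendsto_diffQuot (hs.hasDeriv_U t)))
  have h1 := tendsto_integral_inner_diffQuot hs.hasDeriv_z hs.continuous_w hs.hasDeriv_z
    hs.continuous_w hT
  have h2 := tendsto_integral_inner_diffQuot hQ hQ' hs.hasDeriv_U hs.continuous_V hT
  refine tendsto_nhds_unique ?_ ((hlim T).sub (hlim 0))
  have h3 := (h1.const_mul (-α)).add h2
  have cw := hs.continuous_w
  have cV := hs.continuous_V
  rw [← intervalIntegral.integral_const_mul, ← intervalIntegral.integral_add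
    (Continuous.intervalIntegrable (by fun_prop) _ _)
    (Continuous.intervalIntegrable (by fun_prop) _ _)] at h3
  simp only [real_inner_self_eq_norm_sq] at h3
  refine h3.congr' ?_
  filter_upwards [self_mem_nhdsWithin] with h hh
  rw [← hs.integral_diffQuot hQdef hq hQ hT hh, intervalIntegral.integral_add,
    intervalIntegral.integral_const_mul]
  · simp only [real_inner_self_eq_norm_sq]
  all_goals
    have cz := continuous_diffQuot hs.continuous_z h
    have cU := continuous_diffQuot hs.continuous_U h
    have cQ := continuous_diffQuot hQc h
    exact Continuous.intervalIntegrable (by fun_prop) _ _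

end ExtendedSolution

end Identity

end MGT

/-! ### Weighted memory estimates and dissipation of the energy. -/

namespace MGT

variable {X : Type*} [NormedAddCommGroup X]

theorem memoryQuad_nonneg {p : ℝ → ℝ} (U : ℝ → X) (hp : ∀ t, 0 ≤ t → 0 ≤ p t) {t : ℝ}
    (ht : 0 ≤ t) : 0 ≤ memoryQuad p U t :=
  intervalIntegral.integral_nonneg ht fun _ hs =>
    mul_nonneg (hp _ (sub_nonneg.2 hs.2)) (sq_nonneg _)

variable [InnerProductSpace ℝ X]

/-- `∫₀ᵗ p(t-s) (U(t) - U(s), x) ds`. -/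
noncomputable def memoryInner (p : ℝ → ℝ) (U : ℝ → X) (t : ℝ) (x : X) : ℝ :=
  ∫ s in (0 : ℝ)..t, p (t - s) * ⟪U t - U s, x⟫_ℝ

theorem two_mul_mul_mul_le {p q r x y θ : ℝ} (hq : 0 ≤ q) (hr : 0 ≤ r) (h : p ^ 2 ≤ q * r)
    (hθ : 0 < θ) : 2 * (p * (x * y)) ≤ θ * (r * x ^ 2) + q / θ * y ^ 2 := by
  refine le_of_abs_le (abs_le_of_sq_le_sq ?_ (by positivity))
  have h1 : (2 * (p * (x * y))) ^ 2 ≤ 4 * (q * r) * (x * y) ^ 2 := by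
    nlinarith [mul_le_mul_of_nonneg_right h (sq_nonneg (x * y))]
  have h2 : (θ * (r * x ^ 2)) * (q / θ * y ^ 2) = (q * r) * (x * y) ^ 2 := by
    field_simp
  nlinarith [sq_nonneg (θ * (r * x ^ 2) - q / θ * y ^ 2)]

/-- Pointwise Young's inequality with the kernel split as `p ^ 2 ≤ q * r`: the mass of `q` falls on
`x`, while `r` stays in the memory term. The freedom to choose `q` different from `p` is what lets a
weight of small mass enter later. -/
theorem two_mul_abs_memoryInner_le {p q r : ℝ → ℝ} {U : ℝ → X} (hp : Continuous p)
    (hq : Continuous q) (hr : Continuous r) (hU : Continuous U) (hq0 : ∀ t, 0 ≤ t → 0 ≤ q t)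
    (hr0 : ∀ t, 0 ≤ t → 0 ≤ r t) (hpqr : ∀ t, 0 ≤ t → p t ^ 2 ≤ q t * r t) {θ t : ℝ}
    (hθ : 0 < θ) (ht : 0 ≤ t) (x : X) :
    2 * |memoryInner p U t x| ≤
      θ * memoryQuad r U t + (∫ s in (0 : ℝ)..t, q s) / θ * ‖x‖ ^ 2 := by
  have h1 : |memoryInner p U t x| ≤ ∫ s in (0 : ℝ)..t, |p (t - s) * ⟪U t - U s, x⟫_ℝ| :=
    intervalIntegral.abs_integral_le_integral_abs ht
  have h2 : ∫ s in (0 : ℝ)..t, 2 * |p (t - s) * ⟪U t - U s, x⟫_ℝ| ≤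
      ∫ s in (0 : ℝ)..t, (θ * (r (t - s) * ‖U t - U s‖ ^ 2) + q (t - s) * (‖x‖ ^ 2 / θ)) := by
    refine intervalIntegral.integral_mono_on ht (Continuous.intervalIntegrable (by fun_prop) _ _)
      (Continuous.intervalIntegrable (by fun_prop) _ _) fun s hs => ?_
    have hts : 0 ≤ t - s := sub_nonneg.2 hs.2
    have h3 := two_mul_mul_mul_le (p := |p (t - s)|) (x := ‖U t - U s‖) (y := ‖x‖) (hq0 _ hts)
      (hr0 _ hts) (by simpa using hpqr _ hts) hθ
    rw [abs_mul]
    have h4 := mul_le_mul_of_nonneg_left (abs_real_inner_le_norm (U t - U s) x)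
      (abs_nonneg (p (t - s)))
    calc _ ≤ _ := mul_le_mul_of_nonneg_left h4 zero_le_two
      _ ≤ _ := h3
      _ = _ := by ring
  rw [intervalIntegral.integral_const_mul, intervalIntegral.integral_add
    (Continuous.intervalIntegrable (by fun_prop) _ _)
    (Continuous.intervalIntegrable (by fun_prop) _ _), intervalIntegral.integral_const_mul,
    intervalIntegral.integral_mul_const, integral_comp_reflect q] at h2
  rw [memoryQuad]
  calc _ ≤ _ := mul_le_mul_of_nonneg_left h1 zero_le_two
    _ ≤ _ := h2
    _ = _ := by ring

/-- A positive nonincreasing `C¹` kernel with total mass at most `mass`. -/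
structure AdmissibleKernel (g g' : ℝ → ℝ) (mass : ℝ) : Prop where
  hasDeriv : ∀ t, HasDerivAt g (g' t) t
  continuous_deriv : Continuous g'
  pos : ∀ t, 0 < g t
  deriv_nonpos : ∀ t, g' t ≤ 0
  mass_le : ∀ t, 0 ≤ t → ∫ s in (0 : ℝ)..t, g s ≤ mass

namespace AdmissibleKernel

variable {g g' : ℝ → ℝ} {mass : ℝ}

theorem continuous (hg : AdmissibleKernel g g' mass) : Continuous g :=
  continuous_iff_continuousAt.2 fun t => (hg.hasDeriv t).continuousAt

theorem integral_nonneg (hg : AdmissibleKernel g g' mass) {t : ℝ} (ht : 0 ≤ t) :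
    0 ≤ ∫ s in (0 : ℝ)..t, g s :=
  intervalIntegral.integral_nonneg ht fun s _ => (hg.pos s).le

theorem integral_deriv (hg : AdmissibleKernel g g' mass) (t : ℝ) :
    ∫ s in (0 : ℝ)..t, g' s = g t - g 0 :=
  intervalIntegral.integral_eq_sub_of_hasDerivAt (fun s _ => hg.hasDeriv s)
    (hg.continuous_deriv.intervalIntegrable _ _)

theorem two_mul_abs_memoryInner_le (hg : AdmissibleKernel g g' mass) {U : ℝ → X}
    (hU : Continuous U) {θ t : ℝ} (hθ : 0 < θ) (ht : 0 ≤ t) (x : X) :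
    2 * |memoryInner g U t x| ≤
      θ * memoryQuad g U t + (∫ s in (0 : ℝ)..t, g s) / θ * ‖x‖ ^ 2 :=
  MGT.two_mul_abs_memoryInner_le hg.continuous hg.continuous hg.continuous hU
    (fun t _ => (hg.pos t).le) (fun t _ => (hg.pos t).le) (fun t _ => (sq (g t)).le) hθ ht x

theorem two_mul_abs_memoryInner_deriv_le (hg : AdmissibleKernel g g' mass) {U : ℝ → X}
    (hU : Continuous U) {θ t : ℝ} (hθ : 0 < θ) (ht : 0 ≤ t) (x : X) :
    2 * |memoryInner g' U t x| ≤
      θ * memoryQuad (fun t => -g' t) U t + (g 0 - g t) / θ * ‖x‖ ^ 2 := by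
  have h := MGT.two_mul_abs_memoryInner_le (p := g') (q := fun t => -g' t) (r := fun t => -g' t)
    hg.continuous_deriv hg.continuous_deriv.neg hg.continuous_deriv.neg hU
    (fun t _ => neg_nonneg.2 (hg.deriv_nonpos t)) (fun t _ => neg_nonneg.2 (hg.deriv_nonpos t))
    (fun t _ => by rw [neg_mul_neg, sq]) hθ ht x
  rwa [intervalIntegral.integral_neg, hg.integral_deriv, neg_sub] at h

end AdmissibleKernel

/-- The natural energy in terms of extended data. -/
noncomputable def extEnergy (τ α c b : ℝ) (g : ℝ → ℝ) (k : ℝ) (z w U V : ℝ → X) (t : ℝ) : ℝ :=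
  τ * ‖w t‖ ^ 2 + b * ‖V t‖ ^ 2 + 2 * ⟪c ^ 2 • U t - conv g U t, V t⟫_ℝ
    + k * (c ^ 2 * ‖U t‖ ^ 2 + α * ‖z t‖ ^ 2 + 2 * τ * ⟪w t, z t⟫_ℝ
      + memoryQuad g U t - (∫ s in (0 : ℝ)..t, g s) * ‖U t‖ ^ 2)

/-- Centring the history at `U t` exposes the coefficient `c ^ 2 - ∫ g`, which is positive when the
kernel mass is below `c ^ 2`. -/
theorem inner_sub_conv [CompleteSpace X] {g : ℝ → ℝ} {U : ℝ → X} (hg : Continuous g) (hU : Continuous U)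
    (c : ℝ) (t : ℝ) (y : X) :
    ⟪c ^ 2 • U t - conv g U t, y⟫_ℝ
      = (c ^ 2 - ∫ s in (0 : ℝ)..t, g s) * ⟪U t, y⟫_ℝ + memoryInner g U t y := by
  rw [memoryInner, integral_conv_inner_sub hg hU, inner_sub_left, real_inner_smul_left]
  ring

namespace ExtendedSolution

variable {S : X →ₗ.[ℝ] X} {τ α c b mass : ℝ} {g g' : ℝ → ℝ} {u v : ℝ → S.domain}
  {x z w U V : ℝ → X}

theorem hasDerivAt_energy₁ [CompleteSpace X] (hs : ExtendedSolution S τ α c b g u v x z w U V)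
    (hg : AdmissibleKernel g g' mass) {t : ℝ} (ht : 0 < t) :
    HasDerivAt (fun t => τ * ‖w t‖ ^ 2 + b * ‖V t‖ ^ 2 + 2 * ⟪c ^ 2 • U t - conv g U t, V t⟫_ℝ)
      (-2 * α * ‖w t‖ ^ 2 + 2 * ⟪c ^ 2 • V t - (g 0 • U t + conv g' U t), V t⟫_ℝ) t := by
  have cU := hs.continuous_U
  have cV := hs.continuous_V
  have cw := hs.continuous_w
  have cc := continuous_conv hg.continuous_deriv cU
  -- The identity on every `[0, T]` presents the energy as a primitive of a continuous function, so
  -- it is differentiable although `w` need not be.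
  have key : ∀ T : ℝ, 0 ≤ T → _ := fun T hT => hs.integral_energy_identity
    (Q := fun t => c ^ 2 • U t - conv g U t)
    (Q' := fun t => c ^ 2 • V t - (g 0 • U t + conv g' U t)) (fun _ => rfl)
    (fun t => ((hs.hasDeriv_U t).const_smul (c ^ 2)).sub
      (hasDerivAt_conv hg.hasDeriv hg.continuous_deriv cU t)) (by fun_prop) (T := T) hT
  have hc : Continuous fun t => -α * ‖w t‖ ^ 2
      + ⟪c ^ 2 • V t - (g 0 • U t + conv g' U t), V t⟫_ℝ := by fun_prop
  have h1 : HasDerivAt _ _ t := intervalIntegral.integral_hasDerivAt_right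
    (hc.intervalIntegrable 0 t) (hc.stronglyMeasurableAtFilter _ _) hc.continuousAt
  refine ((h1.const_mul 2).add_const (2 * (τ / 2 * ‖w 0‖ ^ 2 + b / 2 * ‖V 0‖ ^ 2
    + ⟪c ^ 2 • U 0 - conv g U 0, V 0⟫_ℝ))).congr_of_eventuallyEq ?_ |>.congr_deriv (by ring)
  filter_upwards [lt_mem_nhds ht] with T hT
  rw [key T hT.le]
  ring

theorem hasDerivAt_energy₂ [CompleteSpace X] (hs : ExtendedSolution S τ α c b g u v x z w U V)
    (hg : AdmissibleKernel g g' mass) {t : ℝ} (ht : 0 < t) :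
    HasDerivAt (fun t => c ^ 2 * ‖U t‖ ^ 2 + α * ‖z t‖ ^ 2 + 2 * τ * ⟪w t, z t⟫_ℝ
      + memoryQuad g U t - (∫ s in (0 : ℝ)..t, g s) * ‖U t‖ ^ 2)
      (2 * τ * ‖w t‖ ^ 2 - 2 * b * ‖V t‖ ^ 2 + memoryQuad g' U t - g t * ‖U t‖ ^ 2) t := by
  have cU := hs.continuous_U
  have h1 := (hs.hasDeriv_U t).norm_sq.const_mul (c ^ 2)
  have h2 := (hs.hasDeriv_z t).norm_sq.const_mul α
  have h3 := (hs.hasDerivAt_inner ht (v t) (hs.hasDeriv_z t) (hs.eq_v t ht.le)).const_mul 2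
  have h4 := ((hasDerivAt_conv hg.hasDeriv hg.continuous_deriv cU t).inner ℝ
    (hs.hasDeriv_U t)).const_mul (-2)
  have h5 := hasDerivAt_conv hg.hasDeriv hg.continuous_deriv (f := fun t => ‖U t‖ ^ 2)
    (by fun_prop) t
  refine ((((h1.add h2).add h3).add h4).add h5).congr_of_eventuallyEq
    (Eventually.of_forall fun t => ?_) |>.congr_deriv ?_
  · simp only [Pi.add_apply]
    rw [memoryQuad_eq hg.continuous cU]
    ring
  · rw [memoryQuad_eq hg.continuous_deriv cU, hg.integral_deriv, ← hs.eq_V t ht.le]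
    simp only [inner_add_left, inner_smul_left, RCLike.conj_to_real, smul_eq_mul,
      real_inner_self_eq_norm_sq]
    rw [real_inner_comm (w t) (z t)]
    ring

theorem hasDerivAt_extEnergy [CompleteSpace X] (hs : ExtendedSolution S τ α c b g u v x z w U V)
    (hg : AdmissibleKernel g g' mass) (k : ℝ) {t : ℝ} (ht : 0 < t) :
    HasDerivAt (extEnergy τ α c b g k z w U V)
      (-2 * (α - k * τ) * ‖w t‖ ^ 2 - 2 * (k * b - c ^ 2) * ‖V t‖ ^ 2 - 2 * g t * ⟪U t, V t⟫_ℝ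
        + 2 * memoryInner g' U t (V t)
        - k * (memoryQuad (fun t => -g' t) U t + g t * ‖U t‖ ^ 2)) t := by
  refine ((hs.hasDerivAt_energy₁ hg ht).add ((hs.hasDerivAt_energy₂ hg ht).const_mul k)).congr_deriv
    ?_
  rw [memoryInner, integral_conv_inner_sub hg.continuous_deriv hs.continuous_U, hg.integral_deriv]
  have : memoryQuad (fun t => -g' t) U t = - memoryQuad g' U t := by
    simp [memoryQuad]
  simp only [this, inner_sub_left, inner_add_left, inner_smul_left, RCLike.conj_to_real,
    real_inner_self_eq_norm_sq]
  ring

/-- Half of the `-g'` memory dissipation pays for the `g'` cross term, and `k * g t * ‖U t‖ ^ 2`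
pays for the term `⟪U t, V t⟫`. The `g t` contributions to `‖V t‖ ^ 2` then combine with a
favourable sign, leaving only `g 0 / k`. -/
theorem deriv_extEnergy_le [CompleteSpace X] (hs : ExtendedSolution S τ α c b g u v x z w U V)
    (hg : AdmissibleKernel g g' mass) {k : ℝ} (hk : 0 < k) {t : ℝ} (ht : 0 < t) :
    deriv (extEnergy τ α c b g k z w U V) t ≤
      -2 * (α - k * τ) * ‖w t‖ ^ 2 - 2 * (k * b - c ^ 2 - g 0 / k) * ‖V t‖ ^ 2
        - k / 2 * memoryQuad (fun t => -g' t) U t := by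
  rw [(hs.hasDerivAt_extEnergy hg k ht).deriv]
  have h1 := hg.two_mul_abs_memoryInner_deriv_le hs.continuous_U (half_pos hk) ht.le (V t)
  have h2 := le_abs_self (memoryInner g' U t (V t))
  have h3 := two_mul_mul_mul_le (p := g t) (x := ‖U t‖) (y := ‖V t‖) (hg.pos t).le (hg.pos t).le
    (sq (g t)).le hk
  have h4 := mul_le_mul_of_nonneg_left (neg_le_of_abs_le (abs_real_inner_le_norm (U t) (V t)))
    (hg.pos t).le
  have h5 : 0 ≤ g t / k * ‖V t‖ ^ 2 := by have := hg.pos t; positivity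
  have h6 : (g 0 - g t) / (k / 2) * ‖V t‖ ^ 2
      = 2 * (g 0 / k * ‖V t‖ ^ 2) - 2 * (g t / k * ‖V t‖ ^ 2) := by field_simp
  nlinarith

end ExtendedSolution

end MGT

/-! ### Small weights, the tail functional and equivalence of energy and norm. -/

namespace MGT

theorem antitoneOn_Ici_of_hasDerivAt {f f' : ℝ → ℝ} (hc : ContinuousOn f (Ici 0))
    (hf : ∀ t, 0 < t → HasDerivAt f (f' t) t) (hf' : ∀ t, 0 < t → f' t ≤ 0) :
    AntitoneOn f (Ici 0) := by
  refine antitoneOn_of_deriv_nonpos (convex_Ici 0) hc ?_ ?_ <;> rw [interior_Ici] <;> intro t ht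
  · exact (hf t ht).differentiableAt.differentiableWithinAt
  · rw [(hf t ht).deriv]
    exact hf' t ht

/-- A kernel with strictly negative derivative is dominated, up to a weight of arbitrarily small
mass, by a combination of itself and its derivative. -/
theorem exists_small_weight {g g' : ℝ → ℝ} {mass : ℝ} (hg : AdmissibleKernel g g' mass)
    (hint : IntegrableOn g (Ioi 0)) (hneg : ∀ t, 0 ≤ t → g' t < 0) {ε : ℝ} (hε : 0 < ε) :
    ∃ C : ℝ, 0 ≤ C ∧ ∃ p : ℝ → ℝ, Continuous p ∧ (∀ t, 0 ≤ p t) ∧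
      (∀ t, 0 ≤ t → ∫ s in (0 : ℝ)..t, p s ≤ ε) ∧
      ∀ t, g t ^ 2 ≤ p t * (g t + C * -g' t) := by
  -- With this choice `g ^ 2 = p a * (g + a⁻¹ * -g')` exactly. Moreover `p a ≤ g`, and `p a` tends
  -- to zero pointwise as `a → 0` because `g' < 0`; dominated convergence makes its mass small.
  let p : ℝ → ℝ → ℝ := fun a t => a * g t ^ 2 / (a * g t - g' t)
  have hden : ∀ a, 0 < a → ∀ t, 0 < a * g t - g' t := fun a ha t => by
    have := mul_pos ha (hg.pos t)
    linarith [hg.deriv_nonpos t]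
  have gc := hg.continuous
  have g'c := hg.continuous_deriv
  have hpc : ∀ a, 0 < a → Continuous (p a) := fun a ha =>
    Continuous.div (by fun_prop) (by fun_prop) fun t => (hden a ha t).ne'
  have hp0 : ∀ a, 0 < a → ∀ t, 0 ≤ p a t := fun a ha t => by
    have := hden a ha t
    positivity
  have hple : ∀ a, 0 < a → ∀ t, p a t ≤ g t := fun a ha t => by
    rw [div_le_iff₀ (hden a ha t)]
    nlinarith [hg.pos t, hg.deriv_nonpos t]
  have hlim : Tendsto (fun a => ∫ t in Ioi (0 : ℝ), p a t) (𝓝[>] 0) (𝓝 (∫ t in Ioi (0 : ℝ), 0)) := by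
    refine tendsto_integral_filter_of_dominated_convergence g ?_ ?_ hint ?_
    · filter_upwards [self_mem_nhdsWithin] with a ha using (hpc a ha).aestronglyMeasurable
    · filter_upwards [self_mem_nhdsWithin] with a ha
      refine Eventually.of_forall fun t => ?_
      rw [Real.norm_of_nonneg (hp0 a ha t)]
      exact hple a ha t
    · refine (ae_restrict_iff' measurableSet_Ioi).2 (Eventually.of_forall fun t ht => ?_)
      have h1 : ContinuousAt (fun a => p a t) 0 := by
        refine ContinuousAt.div (by fun_prop) (by fun_prop) ?_
        have := hneg t (le_of_lt ht)
        simp only [zero_mul, zero_sub]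
        linarith
      have h2 := h1.tendsto.mono_left (nhdsWithin_le_nhds (s := Ioi 0))
      simpa [p] using h2
  rw [integral_zero] at hlim
  obtain ⟨a, hae, ha⟩ := ((hlim.eventually (gt_mem_nhds hε)).and self_mem_nhdsWithin).exists
  have ha : 0 < a := ha
  refine ⟨a⁻¹, by positivity, p a, hpc a ha, hp0 a ha, fun t ht => ?_, fun t => ?_⟩
  · rw [intervalIntegral.integral_of_le ht]
    refine (setIntegral_mono_set (hint.mono' (hpc a ha).aestronglyMeasurable ?_)
      (Eventually.of_forall (hp0 a ha)) (Ioc_subset_Ioi_self.eventuallyLE)).trans hae.le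
    refine Eventually.of_forall fun t => ?_
    rw [Real.norm_of_nonneg (hp0 a ha t)]
    exact hple a ha t
  · have := hden a ha t
    refine le_of_eq ?_
    simp only [p]
    rw [div_mul_eq_mul_div, eq_div_iff this.ne']
    field_simp
    ring

variable {X : Type*} [NormedAddCommGroup X]

theorem memoryQuad_add_mul {p q : ℝ → ℝ} {U : ℝ → X} (hp : Continuous p) (hq : Continuous q)
    (hU : Continuous U) (C t : ℝ) :
    memoryQuad (fun s => p s + C * q s) U t = memoryQuad p U t + C * memoryQuad q U t := by
  rw [memoryQuad, memoryQuad, memoryQuad, ← intervalIntegral.integral_const_mul,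
    ← intervalIntegral.integral_add]
  · congr 1
    ext s
    ring
  · exact Continuous.intervalIntegrable (by fun_prop) _ _
  · exact Continuous.intervalIntegrable (by fun_prop) _ _

theorem norm_sub_sq_le (a b : X) : ‖a - b‖ ^ 2 ≤ 2 * ‖a‖ ^ 2 + 2 * ‖b‖ ^ 2 := by
  have := norm_sub_le a b
  nlinarith [norm_nonneg (a - b), sq_nonneg (‖a‖ - ‖b‖)]

theorem memoryQuad_le {p : ℝ → ℝ} {U : ℝ → X} (hp : Continuous p) (hp0 : ∀ t, 0 ≤ p t)
    (hU : Continuous U) {t : ℝ} (ht : 0 ≤ t) :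
    memoryQuad p U t ≤
      2 * ((∫ s in (0 : ℝ)..t, p s) * ‖U t‖ ^ 2) + 2 * conv p (fun s => ‖U s‖ ^ 2) t := by
  rw [← integral_comp_reflect p t, conv, ← intervalIntegral.integral_mul_const,
    ← intervalIntegral.integral_const_mul, ← intervalIntegral.integral_const_mul,
    ← intervalIntegral.integral_add]
  · refine intervalIntegral.integral_mono_on ht (Continuous.intervalIntegrable (by fun_prop) _ _)
      (Continuous.intervalIntegrable (by fun_prop) _ _) fun s _ => ?_
    have := mul_le_mul_of_nonneg_left (norm_sub_sq_le (U t) (U s)) (hp0 (t - s))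
    rw [smul_eq_mul]
    linarith
  · exact Continuous.intervalIntegrable (by fun_prop) _ _
  · exact Continuous.intervalIntegrable (by fun_prop) _ _

/-- The functional `∫₀ᵗ (mass - ∫₀^{t-s} g) ‖U(s)‖² ds`, whose derivative controls the memory. -/
noncomputable def tailFunctional (mass : ℝ) (g : ℝ → ℝ) (U : ℝ → X) : ℝ → ℝ :=
  conv (fun r => mass - ∫ s in (0 : ℝ)..r, g s) fun s => ‖U s‖ ^ 2

theorem tailFunctional_nonneg {g g' : ℝ → ℝ} {mass : ℝ} (hg : AdmissibleKernel g g' mass)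
    (U : ℝ → X) {t : ℝ} (ht : 0 ≤ t) : 0 ≤ tailFunctional mass g U t :=
  intervalIntegral.integral_nonneg ht fun _ hs =>
    mul_nonneg (sub_nonneg.2 (hg.mass_le _ (sub_nonneg.2 hs.2))) (sq_nonneg _)

theorem hasDerivAt_tailFunctional {g g' : ℝ → ℝ} {mass : ℝ} (hg : AdmissibleKernel g g' mass)
    {U : ℝ → X} (hU : Continuous U) (t : ℝ) :
    HasDerivAt (tailFunctional mass g U)
      (mass * ‖U t‖ ^ 2 - conv g (fun s => ‖U s‖ ^ 2) t) t := by
  have h1 : ∀ r, HasDerivAt (fun r => mass - ∫ s in (0 : ℝ)..r, g s) (-g r) r := fun r =>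
    (intervalIntegral.integral_hasDerivAt_right (hg.continuous.intervalIntegrable _ _)
      (hg.continuous.stronglyMeasurableAtFilter _ _) hg.continuous.continuousAt).const_sub mass
  refine (hasDerivAt_conv h1 hg.continuous.neg (f := fun s => ‖U s‖ ^ 2) (by fun_prop)
    t).congr_deriv ?_
  simp [conv, sub_eq_add_neg]

variable [InnerProductSpace ℝ X]

theorem two_mul_abs_inner_le (a b : X) {θ : ℝ} (hθ : 0 < θ) :
    2 * |⟪a, b⟫_ℝ| ≤ θ * ‖a‖ ^ 2 + ‖b‖ ^ 2 / θ := by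
  have h1 := two_mul_mul_mul_le (p := 1) (x := ‖a‖) (y := ‖b‖) zero_le_one zero_le_one
    (by norm_num) hθ
  have h2 := abs_real_inner_le_norm a b
  calc _ ≤ 2 * (1 * (‖a‖ * ‖b‖)) := by linarith
    _ ≤ _ := h1
    _ = _ := by ring

/-- The square of the phase space norm, memory included. -/
noncomputable def phaseNorm (g : ℝ → ℝ) (z w U V : ℝ → X) (t : ℝ) : ℝ :=
  ‖w t‖ ^ 2 + ‖z t‖ ^ 2 + ‖V t‖ ^ 2 + ‖U t‖ ^ 2 + memoryQuad g U t

section Coercivity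

variable [CompleteSpace X] {τ α c b mass k : ℝ} {g g' : ℝ → ℝ}

/-- Each end of the interval for `k` leaves room for one Young parameter: `θ` in `(c ^ 2 / b, k)`
for the products of `V` with `U` and its history, and `σ` in `(k, α / τ)` for `⟪w, z⟫`. All five
remaining coefficients are then strictly positive. -/
theorem exists_mul_phaseNorm_le_extEnergy (hτ : 0 < τ) (hb : 0 < b)
    (hg : AdmissibleKernel g g' mass) (hmass : mass < c ^ 2)
    (hk : k ∈ Ioo (c ^ 2 / b) (α / τ)) (z w : ℝ → X) {U : ℝ → X} (V : ℝ → X)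
    (hU : Continuous U) :
    ∃ κ, 0 < κ ∧ ∀ t, 0 ≤ t → κ * phaseNorm g z w U V t ≤ extEnergy τ α c b g k z w U V t := by
  obtain ⟨θ, hθ1, hθk⟩ := exists_between hk.1
  obtain ⟨σ, hkσ, hσ1⟩ := exists_between hk.2
  have hθ0 : 0 < θ := (div_nonneg (sq_nonneg c) hb.le).trans_lt hθ1
  have hk0 : 0 < k := hθ0.trans hθk
  have hσ0 : 0 < σ := hk0.trans hkσ
  have a1 : 0 < τ * (1 - k / σ) := mul_pos hτ (sub_pos.2 ((div_lt_one hσ0).2 hkσ))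
  have a2 : 0 < k * (α - τ * σ) := mul_pos hk0 (by rw [lt_div_iff₀ hτ] at hσ1; linarith)
  have a3 : 0 < b - c ^ 2 / θ := by
    rw [div_lt_iff₀ hb] at hθ1
    rw [sub_pos, div_lt_iff₀ hθ0]; linarith
  have a4 : 0 < (c ^ 2 - mass) * (k - θ) := mul_pos (sub_pos.2 hmass) (sub_pos.2 hθk)
  have a5 : 0 < k - θ := sub_pos.2 hθk
  refine ⟨min (τ * (1 - k / σ)) (min (k * (α - τ * σ)) (min (b - c ^ 2 / θ)
    (min ((c ^ 2 - mass) * (k - θ)) (k - θ)))), by simp [*], fun t ht => ?_⟩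
  set κ := min (τ * (1 - k / σ)) (min (k * (α - τ * σ)) (min (b - c ^ 2 / θ)
    (min ((c ^ 2 - mass) * (k - θ)) (k - θ)))) with hκ
  have b1 : κ ≤ τ * (1 - k / σ) := by simp [hκ]
  have b2 : κ ≤ k * (α - τ * σ) := by simp [hκ]
  have b3 : κ ≤ b - c ^ 2 / θ := by simp [hκ]
  have b4 : κ ≤ (c ^ 2 - mass) * (k - θ) := by simp [hκ]
  have b5 : κ ≤ k - θ := by simp [hκ]
  have hgh := memoryQuad_nonneg U (fun t _ => (hg.pos t).le) ht
  have hG := hg.mass_le t ht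
  set G := ∫ s in (0 : ℝ)..t, g s with hGdef
  have i1 := two_mul_abs_inner_le (U t) (V t) hθ0
  have i2 := hg.two_mul_abs_memoryInner_le hU hθ0 ht (V t)
  have i3 := two_mul_abs_inner_le (z t) (w t) hσ0
  have j1 := mul_le_mul_of_nonneg_left
    ((mul_le_mul_of_nonneg_left (neg_abs_le ⟪U t, V t⟫_ℝ) zero_le_two)) (show 0 ≤ c ^ 2 - G by linarith)
  have j1' := mul_le_mul_of_nonneg_left i1 (show 0 ≤ c ^ 2 - G by linarith)
  have j2 := neg_abs_le (memoryInner g U t (V t))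
  have j3 := mul_le_mul_of_nonneg_left
    ((mul_le_mul_of_nonneg_left (neg_abs_le ⟪z t, w t⟫_ℝ) zero_le_two)) (show 0 ≤ k * τ by positivity)
  have j3' := mul_le_mul_of_nonneg_left i3 (show 0 ≤ k * τ by positivity)
  have c1 := mul_le_mul_of_nonneg_right b1 (sq_nonneg ‖w t‖)
  have c2 := mul_le_mul_of_nonneg_right b2 (sq_nonneg ‖z t‖)
  have c3 := mul_le_mul_of_nonneg_right b3 (sq_nonneg ‖V t‖)
  have c4 := mul_le_mul_of_nonneg_right b4 (sq_nonneg ‖U t‖)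
  have c5 := mul_le_mul_of_nonneg_right b5 hgh
  have c6 : (c ^ 2 - mass) * ((k - θ) * ‖U t‖ ^ 2) ≤ (c ^ 2 - G) * ((k - θ) * ‖U t‖ ^ 2) :=
    mul_le_mul_of_nonneg_right (by linarith) (by positivity)
  have e1 : (c ^ 2 - G) * (‖V t‖ ^ 2 / θ) + G / θ * ‖V t‖ ^ 2 = c ^ 2 / θ * ‖V t‖ ^ 2 := by ring
  have e2 : k * τ * (‖w t‖ ^ 2 / σ) = τ * (k / σ) * ‖w t‖ ^ 2 := by ring
  rw [extEnergy, inner_sub_conv hg.continuous hU, phaseNorm, ← hGdef, real_inner_comm (z t)]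
  linarith

theorem exists_extEnergy_le_mul_phaseNorm (hτ : 0 < τ) (hα : 0 < α) (hb : 0 < b)
    (hg : AdmissibleKernel g g' mass) (hmass : mass < c ^ 2) (hk : 0 < k)
    (z w : ℝ → X) {U : ℝ → X} (V : ℝ → X) (hU : Continuous U) :
    ∃ κ, 0 < κ ∧ ∀ t, 0 ≤ t → extEnergy τ α c b g k z w U V t ≤ κ * phaseNorm g z w U V t := by
  refine ⟨τ + k * τ + k * α + b + 2 * c ^ 2 + k * c ^ 2 + 1 + k, by positivity, fun t ht => ?_⟩
  have hgh := memoryQuad_nonneg U (fun t _ => (hg.pos t).le) ht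
  have hG := hg.mass_le t ht
  have hG0 := hg.integral_nonneg ht
  set G := ∫ s in (0 : ℝ)..t, g s with hGdef
  have i1 := two_mul_abs_inner_le (U t) (V t) one_pos
  have i2 := hg.two_mul_abs_memoryInner_le hU one_pos ht (V t)
  have i3 := two_mul_abs_inner_le (z t) (w t) one_pos
  rw [div_one] at i1 i2 i3
  have j1 := mul_le_mul_of_nonneg_left
    ((mul_le_mul_of_nonneg_left (le_abs_self ⟪U t, V t⟫_ℝ) zero_le_two)) (show 0 ≤ c ^ 2 - G by linarith)
  have j1' := mul_le_mul_of_nonneg_left i1 (show 0 ≤ c ^ 2 - G by linarith)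
  have j2 := le_abs_self (memoryInner g U t (V t))
  have j3 := mul_le_mul_of_nonneg_left
    ((mul_le_mul_of_nonneg_left (le_abs_self ⟪z t, w t⟫_ℝ) zero_le_two)) (show 0 ≤ k * τ by positivity)
  have j3' := mul_le_mul_of_nonneg_left i3 (show 0 ≤ k * τ by positivity)
  rw [extEnergy, inner_sub_conv hg.continuous hU, phaseNorm, ← hGdef, real_inner_comm (z t)]
  have p1 : 0 ≤ G * ‖U t‖ ^ 2 := by positivity
  have p2 : 0 ≤ c ^ 2 * ‖V t‖ ^ 2 := by positivity
  have p2' : 0 ≤ k * (G * ‖U t‖ ^ 2) := by positivity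
  have p3 : 0 ≤ (k * α + b + 2 * c ^ 2 + k * c ^ 2 + 1 + k) * ‖w t‖ ^ 2 := by positivity
  have p4 : 0 ≤ (τ + b + 2 * c ^ 2 + k * c ^ 2 + 1 + k) * ‖z t‖ ^ 2 := by positivity
  have p5 : 0 ≤ (τ + k * τ + k * α + k * c ^ 2 + 1 + k) * ‖V t‖ ^ 2 := by positivity
  have p6 : 0 ≤ (τ + k * τ + k * α + b + c ^ 2 + 1 + k) * ‖U t‖ ^ 2 := by positivity
  have p7 : 0 ≤ (τ + k * τ + k * α + b + 2 * c ^ 2 + k * c ^ 2) * memoryQuad g U t := by positivity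
  linarith

end Coercivity

end MGT

/-! ### The Lyapunov function and integrability of the energy. -/

namespace MGT

variable {X : Type*} [NormedAddCommGroup X] [InnerProductSpace ℝ X]

theorem continuous_memoryQuad [CompleteSpace X] {p : ℝ → ℝ} {U : ℝ → X} (hp : Continuous p) (hU : Continuous U) :
    Continuous (memoryQuad p U) := by
  have h1 := continuous_conv hp hU
  have h2 := continuous_conv hp (f := fun s => ‖U s‖ ^ 2) (by fun_prop)
  have h3 : Continuous fun t => ∫ s in (0 : ℝ)..t, p s :=
    intervalIntegral.continuous_primitive (fun _ _ => hp.intervalIntegrable _ _) 0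
  rw [funext (memoryQuad_eq hp hU)]
  fun_prop

theorem continuous_extEnergy [CompleteSpace X] (τ α c b k : ℝ) {g : ℝ → ℝ} {z w U V : ℝ → X} (hg : Continuous g)
    (hz : Continuous z) (hw : Continuous w) (hU : Continuous U) (hV : Continuous V) :
    Continuous (extEnergy τ α c b g k z w U V) := by
  have h1 := continuous_conv hg hU
  have h2 := continuous_memoryQuad hg hU
  have h3 : Continuous fun t => ∫ s in (0 : ℝ)..t, g s :=
    intervalIntegral.continuous_primitive (fun _ _ => hg.intervalIntegrable _ _) 0
  unfold extEnergy
  fun_prop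

namespace ExtendedSolution

variable {S : X →ₗ.[ℝ] X} {τ α c b mass lam : ℝ} {g g' : ℝ → ℝ} {u v : ℝ → S.domain}
  {x z w U V : ℝ → X}

theorem norm_sq_z_le (hs : ExtendedSolution S τ α c b g u v x z w U V)
    (hlam : ∀ x : S.domain, ‖(x : X)‖ ≤ lam * ‖S x‖) {t : ℝ} (ht : 0 ≤ t) :
    ‖z t‖ ^ 2 ≤ lam ^ 2 * ‖V t‖ ^ 2 := by
  rw [hs.eq_v t ht, hs.eq_V t ht, ← mul_pow]
  exact pow_le_pow_left₀ (norm_nonneg _) (hlam _) 2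

theorem norm_sq_x_le (hs : ExtendedSolution S τ α c b g u v x z w U V)
    (hlam : ∀ x : S.domain, ‖(x : X)‖ ≤ lam * ‖S x‖) {t : ℝ} (ht : 0 ≤ t) :
    ‖x t‖ ^ 2 ≤ lam ^ 2 * ‖U t‖ ^ 2 := by
  rw [hs.eq_u t ht, hs.eq_U t ht, ← mul_pow]
  exact pow_le_pow_left₀ (norm_nonneg _) (hlam _) 2

theorem hasDerivAt_cross [CompleteSpace X] (hs : ExtendedSolution S τ α c b g u v x z w U V)
    (hg : AdmissibleKernel g g' mass) {t : ℝ} (ht : 0 < t) :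
    HasDerivAt (fun t => τ * ⟪w t, x t⟫_ℝ)
      (τ * ⟪w t, z t⟫_ℝ - (α * ⟪w t, x t⟫_ℝ + (c ^ 2 - ∫ s in (0 : ℝ)..t, g s) * ‖U t‖ ^ 2
        + b * ⟪V t, U t⟫_ℝ + memoryInner g U t (U t))) t := by
  refine (hs.hasDerivAt_inner ht (u t) (hs.hasDeriv_x t ht) (hs.eq_u t ht.le)).congr_deriv ?_
  have h := inner_sub_conv hg.continuous hs.continuous_U c t (U t)
  rw [inner_sub_left, real_inner_smul_left, real_inner_self_eq_norm_sq] at h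
  rw [← hs.eq_U t ht.le, real_inner_self_eq_norm_sq]
  linarith

/-- The derivative of `τ (u_tt, u)` controls the potential energy, with an arbitrarily small loss
in the memory term. -/
theorem exists_cross_deriv_le (hs : ExtendedSolution S τ α c b g u v x z w U V)
    (hg : AdmissibleKernel g g' mass) (hτ : 0 < τ) (hα : 0 < α) (hb : 0 < b)
    (hmass : mass < c ^ 2) (hlam : ∀ x : S.domain, ‖(x : X)‖ ≤ lam * ‖S x‖)
    (hint : IntegrableOn g (Ioi 0)) (hneg : ∀ t, 0 ≤ t → g' t < 0) {μ : ℝ} (hμ : 0 < μ) :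
    ∃ C, 0 ≤ C ∧ ∀ t, 0 < t →
      τ * ⟪w t, z t⟫_ℝ - (α * ⟪w t, x t⟫_ℝ + (c ^ 2 - ∫ s in (0 : ℝ)..t, g s) * ‖U t‖ ^ 2
        + b * ⟪V t, U t⟫_ℝ + memoryInner g U t (U t)) ≤
      -((c ^ 2 - mass) / 2) * ‖U t‖ ^ 2 + μ / 4 * memoryQuad g U t
        + C * (‖w t‖ ^ 2 + ‖V t‖ ^ 2 + memoryQuad (fun t => -g' t) U t) := by
  set m := c ^ 2 - mass with hm
  have hm0 : 0 < m := sub_pos.2 hmass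
  -- The mass `m * μ / 8` and the parameters `θ`, `θ'` below are set so that the memory, `α` and `b`
  -- terms each cost `m / 8` of `‖U t‖ ^ 2`, leaving more than `m / 2`.
  obtain ⟨C, hC, p, hp, hp0, hpint, hpg⟩ :=
    exists_small_weight hg hint hneg (show 0 < m * μ / 8 by positivity)
  have g'c := hg.continuous_deriv
  have gc := hg.continuous
  have hθ : 0 < m / (4 * α * (lam ^ 2 + 1)) := by positivity
  have hθ' : 0 < m / (4 * b) := by positivity
  set θ := m / (4 * α * (lam ^ 2 + 1)) with hθdef
  set θ' := m / (4 * b) with hθ'def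
  refine ⟨τ / 2 * (1 + lam ^ 2) + α / (2 * θ) + b / (2 * θ') + μ / 4 * C, by positivity,
    fun t ht => ?_⟩
  have hz := hs.norm_sq_z_le hlam ht.le
  have hx := hs.norm_sq_x_le hlam ht.le
  have i1 := two_mul_abs_inner_le (w t) (z t) one_pos
  have i2 := two_mul_abs_inner_le (x t) (w t) hθ
  have i3 := two_mul_abs_inner_le (U t) (V t) hθ'
  have i4 := MGT.two_mul_abs_memoryInner_le (p := g) (q := p) (r := fun t => g t + C * -g' t)
    gc hp (by fun_prop) hs.continuous_U (fun t _ => hp0 t)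
    (fun t _ => add_nonneg (hg.pos t).le (mul_nonneg hC (neg_nonneg.2 (hg.deriv_nonpos t))))
    (fun t _ => hpg t) (half_pos hμ) ht.le (U t)
  rw [memoryQuad_add_mul (q := fun s => -g' s) gc g'c.neg hs.continuous_U] at i4
  have hG := mul_le_mul_of_nonneg_right (hg.mass_le t ht.le) (sq_nonneg ‖U t‖)
  have hpU : (∫ s in (0 : ℝ)..t, p s) / (μ / 2) * ‖U t‖ ^ 2 ≤ m / 4 * ‖U t‖ ^ 2 := by
    refine mul_le_mul_of_nonneg_right ?_ (sq_nonneg _)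
    rw [div_le_iff₀ (half_pos hμ)]
    linarith [hpint t ht.le]
  have hh := memoryQuad_nonneg (p := fun t => -g' t) U
    (fun t _ => neg_nonneg.2 (hg.deriv_nonpos t)) ht.le
  have j1 : τ * ⟪w t, z t⟫_ℝ ≤ τ / 2 * (‖w t‖ ^ 2 + lam ^ 2 * ‖V t‖ ^ 2) := by
    have := le_abs_self ⟪w t, z t⟫_ℝ
    nlinarith
  have j2 : -(α * ⟪w t, x t⟫_ℝ) ≤ m / 8 * ‖U t‖ ^ 2 + α / (2 * θ) * ‖w t‖ ^ 2 := by
    have h1 := neg_abs_le ⟪x t, w t⟫_ℝ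
    rw [real_inner_comm (x t)]
    have h2 : α / 2 * (θ * ‖x t‖ ^ 2) ≤ m / 8 * ‖U t‖ ^ 2 := by
      calc α / 2 * (θ * ‖x t‖ ^ 2) ≤ α / 2 * (θ * ((lam ^ 2 + 1) * ‖U t‖ ^ 2)) := by
            gcongr
            linarith [sq_nonneg ‖U t‖]
        _ = m / 8 * ‖U t‖ ^ 2 := by rw [hθdef]; field_simp; ring
    have h3 : α / 2 * (‖w t‖ ^ 2 / θ) = α / (2 * θ) * ‖w t‖ ^ 2 := by field_simp
    have h4 := mul_le_mul_of_nonneg_left i2 (half_pos hα).le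
    have h5 := mul_le_mul_of_nonneg_left h1 hα.le
    linarith
  have j3 : -(b * ⟪V t, U t⟫_ℝ) ≤ m / 8 * ‖U t‖ ^ 2 + b / (2 * θ') * ‖V t‖ ^ 2 := by
    have h1 := neg_abs_le ⟪U t, V t⟫_ℝ
    rw [real_inner_comm (U t)]
    have h2 : b / 2 * (θ' * ‖U t‖ ^ 2) = m / 8 * ‖U t‖ ^ 2 := by
      rw [hθ'def]; field_simp; ring
    have h3 : b / 2 * (‖V t‖ ^ 2 / θ') = b / (2 * θ') * ‖V t‖ ^ 2 := by field_simp
    have h4 := mul_le_mul_of_nonneg_left i3 (half_pos hb).le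
    have h5 := mul_le_mul_of_nonneg_left h1 hb.le
    linarith
  have j4 := neg_abs_le (memoryInner g U t (U t))
  have q1 : 0 ≤ (τ / 2 * lam ^ 2 + b / (2 * θ') + μ / 4 * C) * ‖w t‖ ^ 2 := by positivity
  have q2 : 0 ≤ (τ / 2 + α / (2 * θ) + μ / 4 * C) * ‖V t‖ ^ 2 := by positivity
  have q3 : 0 ≤ (τ / 2 * (1 + lam ^ 2) + α / (2 * θ) + b / (2 * θ'))
    * memoryQuad (fun t => -g' t) U t := by positivity
  have q4 : 0 ≤ m / 8 * ‖U t‖ ^ 2 := by positivity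
  have q5 : c ^ 2 = m + mass := by rw [hm]; ring
  rw [q5]
  linarith

theorem abs_cross_le (hs : ExtendedSolution S τ α c b g u v x z w U V)
    (hg : AdmissibleKernel g g' mass) (hτ : 0 < τ)
    (hlam : ∀ x : S.domain, ‖(x : X)‖ ≤ lam * ‖S x‖) {t : ℝ} (ht : 0 ≤ t) :
    |τ * ⟪w t, x t⟫_ℝ| ≤ τ * (1 + lam ^ 2) * phaseNorm g z w U V t := by
  have i1 := two_mul_abs_inner_le (w t) (x t) one_pos
  have hx := hs.norm_sq_x_le hlam ht
  have hgh := memoryQuad_nonneg U (fun t _ => (hg.pos t).le) ht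
  rw [abs_mul, abs_of_pos hτ, mul_assoc]
  refine mul_le_mul_of_nonneg_left ?_ hτ.le
  rw [phaseNorm]
  have q1 : 0 ≤ (1 / 2 + lam ^ 2) * ‖w t‖ ^ 2 := by positivity
  have q2 : 0 ≤ (1 + lam ^ 2) * ‖z t‖ ^ 2 := by positivity
  have q3 : 0 ≤ (1 + lam ^ 2) * ‖V t‖ ^ 2 := by positivity
  have q4 : 0 ≤ (1 + lam ^ 2 / 2) * ‖U t‖ ^ 2 := by positivity
  have q5 : 0 ≤ (1 + lam ^ 2) * memoryQuad g U t := by positivity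
  linarith

theorem exists_lyapunov [CompleteSpace X] (hs : ExtendedSolution S τ α c b g u v x z w U V)
    (hg : AdmissibleKernel g g' mass) (hτ : 0 < τ) (hα : 0 < α) (hb : 0 < b) (hc : 0 < c)
    (hmass : mass < c ^ 2) (hlam : ∀ x : S.domain, ‖(x : X)‖ ≤ lam * ‖S x‖)
    (hint : IntegrableOn g (Ioi 0)) (hneg : ∀ t, 0 ≤ t → g' t < 0) {k : ℝ}
    (hk : k ∈ Ioo (c ^ 2 / b) (α / τ)) (hgk : g 0 < k * (k * b - c ^ 2)) :
    ∃ a C M : ℝ, 0 < a ∧ 0 < C ∧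
      (∀ t, 0 < t → deriv (extEnergy τ α c b g k z w U V) t
        ≤ -a * memoryQuad (fun t => -g' t) U t) ∧
      (∀ t, 0 ≤ t → ∫ s in (0 : ℝ)..t, extEnergy τ α c b g k z w U V s ≤ M) ∧
      ∃ L L' : ℝ → ℝ, Continuous L ∧ (∀ t, 0 < t → HasDerivAt L (L' t) t) ∧
        (∀ t, 0 < t → L' t ≤ -a * extEnergy τ α c b g k z w U V t + C * memoryQuad g U t) ∧
        ∀ t, 0 ≤ t → 0 ≤ L t ∧ L t ≤ C * extEnergy τ α c b g k z w U V t := by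
  have hk0 : 0 < k := (div_nonneg (sq_nonneg c) hb.le).trans_lt hk.1
  set F := extEnergy τ α c b g k z w U V with hF
  set N := phaseNorm g z w U V with hN
  set R : ℝ → ℝ := memoryQuad (fun t => -g' t) U with hR
  have hR0 : ∀ t, 0 ≤ t → 0 ≤ R t := fun t ht =>
    memoryQuad_nonneg U (fun t _ => neg_nonneg.2 (hg.deriv_nonpos t)) ht
  have hM0 : ∀ t, 0 ≤ t → 0 ≤ memoryQuad g U t := fun t ht =>
    memoryQuad_nonneg U (fun t _ => (hg.pos t).le) ht
  have hN0 : ∀ t, 0 ≤ t → 0 ≤ N t := fun t ht => by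
    have := hM0 t ht
    rw [hN, phaseNorm]; positivity
  -- dissipation of the energy
  have hdiss : ∃ a₁, 0 < a₁ ∧ ∀ t, 0 < t → deriv F t ≤ -a₁ * (‖w t‖ ^ 2 + ‖V t‖ ^ 2 + R t) := by
    have d1 : 0 < 2 * (α - k * τ) := by
      have := (lt_div_iff₀ hτ).1 hk.2
      linarith
    have d2 : 0 < 2 * (k * b - c ^ 2 - g 0 / k) := by
      have := (div_lt_iff₀' hk0).2 hgk
      linarith
    refine ⟨min (2 * (α - k * τ)) (min (2 * (k * b - c ^ 2 - g 0 / k)) (k / 2)),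
      lt_min d1 (lt_min d2 (half_pos hk0)), fun t ht => ?_⟩
    have h1 := hs.deriv_extEnergy_le hg hk0 ht
    set a₁ := min (2 * (α - k * τ)) (min (2 * (k * b - c ^ 2 - g 0 / k)) (k / 2)) with ha₁
    have e1 := mul_le_mul_of_nonneg_right (show a₁ ≤ 2 * (α - k * τ) by simp [ha₁])
      (sq_nonneg ‖w t‖)
    have e2 := mul_le_mul_of_nonneg_right (show a₁ ≤ 2 * (k * b - c ^ 2 - g 0 / k) by simp [ha₁])
      (sq_nonneg ‖V t‖)
    have e3 := mul_le_mul_of_nonneg_right (show a₁ ≤ k / 2 by simp [ha₁]) (hR0 t ht.le)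
    linarith
  obtain ⟨a₁, ha₁, hdiss⟩ := hdiss
  obtain ⟨κ₀, hκ₀, hlow⟩ := exists_mul_phaseNorm_le_extEnergy hτ hb hg hmass hk z w V
    hs.continuous_U
  obtain ⟨κ₁, hκ₁, hup⟩ := exists_extEnergy_le_mul_phaseNorm hτ hα hb hg hmass hk0 z w V
    hs.continuous_U
  have hF0 : ∀ t, 0 ≤ t → 0 ≤ F t := fun t ht =>
    (mul_nonneg hκ₀.le (hN0 t ht)).trans (hlow t ht)
  have hFd : ∀ t, 0 < t → HasDerivAt F (deriv F t) t := fun t ht =>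
    (hs.hasDerivAt_extEnergy hg k ht).differentiableAt.hasDerivAt
  have hFc : Continuous F := continuous_extEnergy τ α c b k hg.continuous hs.continuous_z
    hs.continuous_w hs.continuous_U hs.continuous_V
  -- the Lyapunov function
  set m := c ^ 2 - mass with hm
  have hm0 : 0 < m := sub_pos.2 hmass
  -- Chosen so that `2 * μ * c ^ 2 = m / 4`, the share of `‖U t‖ ^ 2` reserved for the tail
  -- functional.
  set μ := m / (8 * c ^ 2) with hμdef
  have hμ : 0 < μ := by positivity
  have hμc : 2 * μ * c ^ 2 = m / 4 := by rw [hμdef]; field_simp; norm_num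
  obtain ⟨C₁, hC₁, hcross⟩ := hs.exists_cross_deriv_le hg hτ hα hb hmass hlam hint hneg hμ
  set CΛ := τ * (1 + lam ^ 2) / κ₀ with hCΛ
  have hCΛ0 : 0 < CΛ := by positivity
  have hΛ : ∀ t, 0 ≤ t → |τ * ⟪w t, x t⟫_ℝ| ≤ CΛ * F t := fun t ht => by
    refine (hs.abs_cross_le hg hτ hlam ht).trans ?_
    rw [hCΛ, div_mul_eq_mul_div, le_div_iff₀ hκ₀, mul_assoc]
    exact mul_le_mul_of_nonneg_left ((mul_comm _ _).trans_le (hlow t ht)) (by positivity)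
  -- The first summand absorbs the loss `C₁` and leaves a unit of dissipation; the second keeps `L`
  -- nonnegative.
  set P := (C₁ + 1) / a₁ + CΛ with hP
  have hP0 : 0 < P := by positivity
  set L : ℝ → ℝ := fun t => P * F t + τ * ⟪w t, x t⟫_ℝ with hL
  set L' : ℝ → ℝ := fun t => P * deriv F t + (τ * ⟪w t, z t⟫_ℝ
    - (α * ⟪w t, x t⟫_ℝ + (c ^ 2 - ∫ s in (0 : ℝ)..t, g s) * ‖U t‖ ^ 2
        + b * ⟪V t, U t⟫_ℝ + memoryInner g U t (U t))) with hL'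
  have hLd : ∀ t, 0 < t → HasDerivAt L (L' t) t := fun t ht =>
    ((hFd t ht).const_mul P).add (hs.hasDerivAt_cross hg ht)
  have hLc : Continuous L := by
    have := hs.continuous_w
    have := hs.continuous_x
    fun_prop
  have hL0 : ∀ t, 0 ≤ t → 0 ≤ L t := fun t ht => by
    have h1 := (abs_le.1 (hΛ t ht)).1
    have h2 : 0 ≤ (C₁ + 1) / a₁ * F t := mul_nonneg (by positivity) (hF0 t ht)
    simp only [hL, hP]
    linarith
  have hLle : ∀ t, 0 ≤ t → L t ≤ (P + CΛ) * F t := fun t ht => by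
    have h1 := (abs_le.1 (hΛ t ht)).2
    simp only [hL]
    linarith
  have hL'le : ∀ t, 0 < t → L' t ≤
      -(‖w t‖ ^ 2 + ‖V t‖ ^ 2) - m / 2 * ‖U t‖ ^ 2 + μ / 4 * memoryQuad g U t := fun t ht => by
    have h1 := hcross t ht
    have h2 := mul_le_mul_of_nonneg_left (hdiss t ht) hP0.le
    have h3 : 0 ≤ ‖w t‖ ^ 2 + ‖V t‖ ^ 2 + R t := by have := hR0 t ht.le; positivity
    have h4 : P * (-a₁ * (‖w t‖ ^ 2 + ‖V t‖ ^ 2 + R t))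
        = -(C₁ + 1) * (‖w t‖ ^ 2 + ‖V t‖ ^ 2 + R t)
          - CΛ * a₁ * (‖w t‖ ^ 2 + ‖V t‖ ^ 2 + R t) := by
      rw [hP]; field_simp; ring
    have h5 : 0 ≤ CΛ * a₁ * (‖w t‖ ^ 2 + ‖V t‖ ^ 2 + R t) := by positivity
    have h6 := hR0 t ht.le
    simp only [hL']
    linarith
  -- comparison of the dissipation with the energy
  set a₂ := min (1 / (1 + lam ^ 2)) (min (m / 4) (μ / 4)) with ha₂def
  have ha₂ : 0 < a₂ := lt_min (by positivity) (lt_min (by positivity) (by positivity))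
  have hcomp : ∀ t, 0 ≤ t → a₂ / κ₁ * F t ≤
      ‖w t‖ ^ 2 + ‖V t‖ ^ 2 + m / 4 * ‖U t‖ ^ 2 + a₂ * memoryQuad g U t := fun t ht => by
    have e0 : a₂ / κ₁ * F t ≤ a₂ * N t := by
      rw [div_mul_eq_mul_div, div_le_iff₀ hκ₁, mul_assoc]
      exact mul_le_mul_of_nonneg_left ((hup t ht).trans_eq (mul_comm _ _)) ha₂.le
    have e1 : a₂ * (1 + lam ^ 2) ≤ 1 := by
      rw [← le_div_iff₀ (by positivity)]; simp [ha₂def]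
    have e2 : a₂ ≤ m / 4 := by simp [ha₂def]
    have e3 := mul_le_mul_of_nonneg_left (hs.norm_sq_z_le hlam ht) ha₂.le
    have e4 := mul_le_mul_of_nonneg_right e1 (sq_nonneg ‖V t‖)
    have e5 := mul_le_mul_of_nonneg_right e2 (sq_nonneg ‖U t‖)
    have e6 : a₂ * ‖w t‖ ^ 2 ≤ 1 * ‖w t‖ ^ 2 :=
      mul_le_mul_of_nonneg_right (by nlinarith [sq_nonneg lam]) (sq_nonneg _)
    refine e0.trans ?_
    rw [hN, phaseNorm]
    linarith
  have ha : 0 < a₂ / κ₁ := by positivity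
  have hUnn : ∀ t, 0 ≤ m / 4 * ‖U t‖ ^ 2 := fun t => by positivity
  -- integrability of the energy
  have hInt : ∀ t, 0 ≤ t → a₂ / κ₁ * ∫ s in (0 : ℝ)..t, F s ≤ L 0 + μ * tailFunctional mass g U 0 := by
    have hTd := hasDerivAt_tailFunctional hg hs.continuous_U
    have hTc : Continuous (tailFunctional mass g U) :=
      continuous_iff_continuousAt.2 fun t => (hTd t).continuousAt
    have hId : ∀ t, HasDerivAt (fun t => ∫ s in (0 : ℝ)..t, F s) (F t) t := fun t =>
      intervalIntegral.integral_hasDerivAt_right (hFc.intervalIntegrable _ _)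
        (hFc.stronglyMeasurableAtFilter _ _) hFc.continuousAt
    have hIc : Continuous fun t => ∫ s in (0 : ℝ)..t, F s :=
      continuous_iff_continuousAt.2 fun t => (hId t).continuousAt
    -- The memory term left over, at most `μ / 2 * memoryQuad g U`, is bounded by `μ * mass * ‖U t‖
    -- ^ 2` plus `μ` times the convolution of `g` with `‖U‖ ^ 2`. The derivative of the tail
    -- functional cancels that convolution and adds a second `μ * mass * ‖U t‖ ^ 2`.
    have hanti := antitoneOn_Ici_of_hasDerivAt
      (f := fun t => L t + μ * tailFunctional mass g U t + a₂ / κ₁ * ∫ s in (0 : ℝ)..t, F s)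
      (f' := fun t => L' t + μ * (mass * ‖U t‖ ^ 2 - conv g (fun s => ‖U s‖ ^ 2) t)
        + a₂ / κ₁ * F t) (by fun_prop)
      (fun t ht => ((hLd t ht).add ((hTd t).const_mul μ)).add ((hId t).const_mul _))
      (fun t ht => by
        have h1 := hL'le t ht
        have h2 := hcomp t ht.le
        have h3 := mul_le_mul_of_nonneg_left (memoryQuad_le hg.continuous (fun t => (hg.pos t).le)
          hs.continuous_U ht.le) hμ.le
        have h4 := mul_le_mul_of_nonneg_left (mul_le_mul_of_nonneg_right (hg.mass_le t ht.le)
          (sq_nonneg ‖U t‖)) hμ.le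
        have h5 := mul_le_mul_of_nonneg_left (mul_le_mul_of_nonneg_right hmass.le
          (sq_nonneg ‖U t‖)) hμ.le
        have h6 : a₂ * memoryQuad g U t ≤ μ / 4 * memoryQuad g U t :=
          mul_le_mul_of_nonneg_right (by simp [ha₂def]) (hM0 t ht.le)
        have h7 : 2 * (μ * (c ^ 2 * ‖U t‖ ^ 2)) = m / 4 * ‖U t‖ ^ 2 := by rw [← hμc]; ring
        linarith)
    intro t ht
    have h1 := hanti self_mem_Ici ht ht
    have h2 := hL0 t ht
    have h3 := mul_nonneg hμ.le (tailFunctional_nonneg hg U ht)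
    simp only [intervalIntegral.integral_same, mul_zero, add_zero] at h1
    linarith
  refine ⟨min a₁ (a₂ / κ₁), P + CΛ + (a₂ + μ / 4),
    (L 0 + μ * tailFunctional mass g U 0) / (a₂ / κ₁), lt_min ha₁ ha, by positivity,
    fun t ht => ?_, fun t ht => ?_, L, L', hLc, hLd, fun t ht => ?_, fun t ht => ⟨hL0 t ht, ?_⟩⟩
  · have h1 := hdiss t ht
    have h2 := mul_le_mul_of_nonneg_right (min_le_left a₁ (a₂ / κ₁)) (hR0 t ht.le)
    have h3 : 0 ≤ a₁ * (‖w t‖ ^ 2 + ‖V t‖ ^ 2) := by positivity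
    linarith
  · rw [le_div_iff₀' ha]
    exact hInt t ht
  · have h1 := hL'le t ht
    have h2 := hcomp t ht.le
    have h3 := mul_le_mul_of_nonneg_right (min_le_right a₁ (a₂ / κ₁)) (hF0 t ht.le)
    have h4 : 0 ≤ (P + CΛ) * memoryQuad g U t := mul_nonneg (by positivity) (hM0 t ht.le)
    linarith [hUnn t]
  · have h1 : 0 ≤ (a₂ + μ / 4) * F t := mul_nonneg (by positivity) (hF0 t ht)
    linarith [hLle t ht]

end ExtendedSolution

end MGT

/-! ### Convexity and comparison with the scalar equation. -/

namespace MGT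

section ConvexFunction

variable {H : ℝ → ℝ}

theorem convex_chord_le (hH : ConvexOn ℝ (Ici 0) H) (h0 : H 0 = 0) {x z : ℝ} (hx : 0 ≤ x)
    (hxz : x ≤ z) (hz : 0 < z) : H x ≤ x / z * H z := by
  have h := hH.2 (mem_Ici.2 hz.le) (mem_Ici.2 le_rfl) (div_nonneg hx hz.le)
    (sub_nonneg.2 ((div_le_one hz).2 hxz)) (add_sub_cancel (x / z) 1)
  simpa [h0, div_mul_cancel₀ x hz.ne'] using h

theorem strictMono_pos (hH : StrictMonoOn H (Ici 0)) (h0 : H 0 = 0) {x : ℝ} (hx : 0 < x) :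
    0 < H x :=
  h0 ▸ hH (mem_Ici.2 le_rfl) hx.le hx

/-- A Young inequality free of convex conjugates. For `z ≤ x` the first term on the right suffices;
for `x ≤ z` the second does, since `H x / x` is nondecreasing. -/
theorem div_mul_le_add (hH : ConvexOn ℝ (Ici 0) H) (hmono : StrictMonoOn H (Ici 0))
    (h0 : H 0 = 0) {x z : ℝ} (hx : 0 < x) (hz : 0 < z) : H x / x * z ≤ H x + H z := by
  have hHx := strictMono_pos hmono h0 hx
  have hHz := strictMono_pos hmono h0 hz
  rw [div_mul_eq_mul_div, div_le_iff₀ hx]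
  rcases le_total z x with h | h
  · nlinarith
  · have h1 := convex_chord_le hH h0 hx.le h hz
    rw [div_mul_eq_mul_div, le_div_iff₀ hz] at h1
    nlinarith

theorem le_mul_deriv (hH : ConvexOn ℝ (Ici 0) H) (h0 : H 0 = 0) {x H' : ℝ} (hx : 0 < x)
    (hd : HasDerivAt H H' x) : H x ≤ H' * x := by
  have h := hH.slope_le_of_hasDerivAt (mem_Ici.2 le_rfl) hx.le hx hd
  rwa [slope_def_field, h0, sub_zero, sub_zero, div_le_iff₀ hx] at h

variable {y : ℝ → ℝ}

theorem ode_antitoneOn (hmono : StrictMonoOn H (Ici 0)) (h0 : H 0 = 0)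
    (hy : ∀ t, 0 ≤ t → 0 ≤ y t)
    (hode : ∀ t, 0 ≤ t → HasDerivWithinAt y (-H (y t)) (Ici 0) t) : AntitoneOn y (Ici 0) :=
  antitoneOn_Ici_of_hasDerivAt (fun t ht => (hode t ht).continuousWithinAt)
    (fun t ht => (hode t ht.le).hasDerivAt (Ici_mem_nhds ht)) fun t ht =>
    neg_nonpos.2 (h0 ▸ hmono.monotoneOn (mem_Ici.2 le_rfl) (hy t ht.le) (hy t ht.le))

/-- On `[0, y 0]` the chord bound gives `H (y) ≤ K * y`, so `y t * exp (K * t)` is nondecreasing and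
extinction in finite time is impossible. -/
theorem ode_pos (hH : ConvexOn ℝ (Ici 0) H) (hmono : StrictMonoOn H (Ici 0)) (h0 : H 0 = 0)
    (hy : ∀ t, 0 ≤ t → 0 ≤ y t) (hy0 : 0 < y 0)
    (hode : ∀ t, 0 ≤ t → HasDerivWithinAt y (-H (y t)) (Ici 0) t) {t : ℝ} (ht : 0 ≤ t) :
    0 < y t := by
  set K := H (y 0) / y 0 with hK
  have hanti := ode_antitoneOn hmono h0 hy hode
  have h := antitoneOn_Ici_of_hasDerivAt
    (f := fun t => -(y t * Real.exp (K * t)))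
    (f' := fun t => -(-H (y t) * Real.exp (K * t) + y t * (Real.exp (K * t) * K)))
    (ContinuousOn.neg (ContinuousOn.mul (fun t ht => (hode t ht).continuousWithinAt)
      (by fun_prop)))
    (fun t ht => (((hode t ht.le).hasDerivAt (Ici_mem_nhds ht)).mul
      (by simpa using! ((hasDerivAt_id t).const_mul K).exp)).neg)
    (fun t ht => by
      have h1 := convex_chord_le hH h0 (hy t ht.le) (hanti (mem_Ici.2 le_rfl) ht.le ht.le) hy0
      have h2 : y t / y 0 * H (y 0) = K * y t := by rw [hK]; ring
      have h3 := Real.exp_pos (K * t)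
      nlinarith)
  have h4 := h (mem_Ici.2 le_rfl) ht ht
  simp only [mul_zero, Real.exp_zero, mul_one, neg_le_neg_iff] at h4
  exact pos_of_mul_pos_left (hy0.trans_le h4) (Real.exp_pos _).le

end ConvexFunction

variable {X : Type*} [NormedAddCommGroup X]

/-- Young's inequality under the memory integral. -/
theorem div_mul_memoryQuad_le {H g q : ℝ → ℝ} (hH : ConvexOn ℝ (Ici 0) H)
    (hmono : StrictMonoOn H (Ici 0)) (h0 : H 0 = 0) (hg : Continuous g) (hq : Continuous q)
    (hgpos : ∀ t, 0 < g t) (hHq : ∀ t, 0 ≤ t → H (g t) ≤ q t) {U : ℝ → X} (hU : Continuous U)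
    {x t : ℝ} (hx : 0 < x) (ht : 0 ≤ t) :
    H x / x * memoryQuad g U t ≤
      H x * (∫ s in (0 : ℝ)..t, ‖U t - U s‖ ^ 2) + memoryQuad q U t := by
  rw [memoryQuad, memoryQuad, ← intervalIntegral.integral_const_mul,
    ← intervalIntegral.integral_const_mul, ← intervalIntegral.integral_add
    (Continuous.intervalIntegrable (by fun_prop) _ _)
    (Continuous.intervalIntegrable (by fun_prop) _ _)]
  refine intervalIntegral.integral_mono_on ht (Continuous.intervalIntegrable (by fun_prop) _ _)
      (Continuous.intervalIntegrable (by fun_prop) _ _) fun s hs => ?_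
  have h1 := div_mul_le_add hH hmono h0 hx (hgpos (t - s))
  have h2 := hHq (t - s) (sub_nonneg.2 hs.2)
  rw [← mul_assoc, ← add_mul]
  exact mul_le_mul_of_nonneg_right (by linarith) (sq_nonneg _)

theorem mul_le_of_antitoneOn {F : ℝ → ℝ} {M : ℝ} (hFc : Continuous F)
    (hF : AntitoneOn F (Ici 0)) (hM : ∀ t, 0 ≤ t → ∫ s in (0 : ℝ)..t, F s ≤ M) {t : ℝ}
    (ht : 0 ≤ t) : t * F t ≤ M := by
  refine le_trans ?_ (hM t ht)
  have h := intervalIntegral.integral_mono_on (μ := volume) ht (intervalIntegrable_const (c := F t))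
    (hFc.intervalIntegrable _ _) fun s hs => hF hs.1 ht hs.2
  simpa using h

/-- The unweighted history stays bounded in time: the part from `U s` by the bound on the integral
of `F`, the part from `U t` because `t * F t ≤ M`. -/
theorem integral_norm_sub_sq_le {F : ℝ → ℝ} {B M : ℝ} {U : ℝ → X} (hU : Continuous U)
    (hFc : Continuous F) (hF : AntitoneOn F (Ici 0)) (hB : 0 ≤ B)
    (hUF : ∀ t, 0 ≤ t → ‖U t‖ ^ 2 ≤ B * F t)
    (hM : ∀ t, 0 ≤ t → ∫ s in (0 : ℝ)..t, F s ≤ M) {t : ℝ} (ht : 0 ≤ t) :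
    ∫ s in (0 : ℝ)..t, ‖U t - U s‖ ^ 2 ≤ 4 * B * M := by
  have h : ∫ s in (0 : ℝ)..t, ‖U t - U s‖ ^ 2 ≤
      ∫ s in (0 : ℝ)..t, (2 * B * F t + 2 * B * F s) := by
    refine intervalIntegral.integral_mono_on ht (Continuous.intervalIntegrable (by fun_prop) _ _)
      (Continuous.intervalIntegrable (by fun_prop) _ _) fun s hs => ?_
    have h1 := norm_sub_sq_le (U t) (U s)
    have h2 := hUF t ht
    have h3 := hUF s hs.1
    linarith
  rw [intervalIntegral.integral_add (Continuous.intervalIntegrable (by fun_prop) _ _)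
    (Continuous.intervalIntegrable (by fun_prop) _ _), intervalIntegral.integral_const_mul] at h
  simp only [intervalIntegral.integral_const, sub_zero, smul_eq_mul,
    intervalIntegral.integral_const_mul] at h
  have h1 := mul_le_mul_of_nonneg_left (mul_le_of_antitoneOn hFc hF hM ht) hB
  have h2 := mul_le_mul_of_nonneg_left (hM t ht) hB
  linarith

/-- Comparison of a Lyapunov pair `F`, `L` with the solution of `y' + H(y) = 0`; `G` stands for
the memory term and `R` for its dissipation. -/
theorem exists_decay_of_lyapunov {H H' y F F' L L' G R : ℝ → ℝ} {a C M : ℝ}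
    (hH : ConvexOn ℝ (Ici 0) H) (hmono : StrictMonoOn H (Ici 0)) (h0 : H 0 = 0)
    (hHd : ∀ x, 0 < x → HasDerivAt H (H' x) x)
    (hy : ∀ t, 0 ≤ t → 0 ≤ y t) (hy0 : 0 < y 0)
    (hode : ∀ t, 0 ≤ t → HasDerivWithinAt y (-H (y t)) (Ici 0) t)
    (ha : 0 < a) (hC : 0 < C) (hM : 0 ≤ M) (hFc : Continuous F) (hLc : Continuous L)
    (hFd : ∀ t, 0 < t → HasDerivAt F (F' t) t) (hLd : ∀ t, 0 < t → HasDerivAt L (L' t) t)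
    (hF' : ∀ t, 0 < t → F' t ≤ -a * R t) (hL' : ∀ t, 0 < t → L' t ≤ -a * F t + C * G t)
    (hF : ∀ t, 0 ≤ t → 0 ≤ F t) (hL : ∀ t, 0 ≤ t → 0 ≤ L t ∧ L t ≤ C * F t)
    (hG : ∀ x, 0 < x → ∀ t, 0 ≤ t → H x / x * G t ≤ M * H x + R t) :
    ∃ C₂ β κ : ℝ, 0 < C₂ ∧ 0 < β ∧ 0 < κ ∧ ∀ t, 0 ≤ t → F t ≤ C₂ * y (β * t + κ) := by
  have hypos : ∀ t, 0 ≤ t → 0 < y t := fun t ht => ode_pos hH hmono h0 hy hy0 hode ht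
  set K := H (y 0) / y 0 with hK
  have hK0 : 0 < K := div_pos (strictMono_pos hmono h0 hy0) hy0
  set C₃ := C * K + C / a with hC₃
  have hC₃0 : 0 < C₃ := by positivity
  set β := a / C₃ / 2 with hβ
  have hβ0 : 0 < β := by positivity
  -- The shift by `1` keeps the argument inside `(0, ∞)`, so `Y` has a two-sided derivative even at
  -- `t = 0`.
  set Y : ℝ → ℝ := fun t => y (β * t + 1) with hYdef
  have harg : ∀ t, 0 ≤ t → 0 < β * t + 1 := fun t ht => by positivity
  have hY : ∀ t, 0 ≤ t → 0 < Y t := fun t ht => hypos _ (harg t ht).le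
  have hYd : ∀ t, 0 ≤ t → HasDerivAt Y (-β * H (Y t)) t := fun t ht => by
    have h1 := (hode _ (harg t ht).le).hasDerivAt (Ici_mem_nhds (harg t ht))
    have h2 : HasDerivAt (fun t => β * t + 1) β t := by
      simpa using! ((hasDerivAt_id t).const_mul β).add_const 1
    exact (h1.comp t h2).congr_deriv (by ring)
  -- Convexity makes `H x / x` nondecreasing and `Y` decreases, so `q' ≤ 0` and the term `q' * L` in
  -- `Φ'` can be discarded.
  set q : ℝ → ℝ := fun t => H (Y t) / Y t with hq
  set q' : ℝ → ℝ := fun t =>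
    (H' (Y t) * (-β * H (Y t)) * Y t - H (Y t) * (-β * H (Y t))) / Y t ^ 2 with hq'
  have hqd : ∀ t, 0 ≤ t → HasDerivAt q (q' t) t := fun t ht =>
    ((hHd _ (hY t ht)).comp t (hYd t ht)).div (hYd t ht) (hY t ht).ne'
  have hHY : ∀ t, 0 ≤ t → 0 < H (Y t) := fun t ht => strictMono_pos hmono h0 (hY t ht)
  have hq'le : ∀ t, 0 ≤ t → q' t ≤ 0 := fun t ht => by
    refine div_nonpos_of_nonpos_of_nonneg ?_ (sq_nonneg _)
    have h1 := le_mul_deriv hH h0 (hY t ht) (hHd _ (hY t ht))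
    have h2 := mul_nonneg (mul_pos hβ0 (hHY t ht)).le (sub_nonneg.2 h1)
    linarith
  have hqK : ∀ t, 0 ≤ t → q t ≤ K := fun t ht => by
    have h1 := convex_chord_le hH h0 (hY t ht).le
      (ode_antitoneOn hmono h0 hy hode (mem_Ici.2 le_rfl) (harg t ht).le (harg t ht).le) hy0
    rw [hq, hK]
    simp only
    rw [div_le_iff₀ (hY t ht)]
    exact h1.trans_eq (by ring)
  -- The weight `C / a` makes the dissipation of `F` cancel exactly the `C * R t` produced by
  -- Young's inequality.
  set Φ : ℝ → ℝ := fun t => q t * L t + C / a * F t with hΦ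
  set Φ' : ℝ → ℝ := fun t => q' t * L t + q t * L' t + C / a * F' t with hΦ'
  have hΦd : ∀ t, 0 < t → HasDerivAt Φ (Φ' t) t := fun t ht =>
    ((hqd t ht.le).mul (hLd t ht)).add ((hFd t ht).const_mul _)
  have hq0 : ∀ t, 0 ≤ t → 0 ≤ q t := fun t ht => (div_pos (hHY t ht) (hY t ht)).le
  have hΦle : ∀ t, 0 ≤ t → Φ t ≤ C₃ * F t := fun t ht => by
    have h1 := mul_le_mul (hqK t ht) (hL t ht).2 (hL t ht).1 hK0.le
    simp only [hΦ, hC₃]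
    linarith
  have hΦ'le : ∀ t, 0 < t → Φ' t ≤ -(2 * β) * (q t * Φ t) + C * M * H (Y t) := fun t ht => by
    have h1 := mul_nonpos_of_nonpos_of_nonneg (hq'le t ht.le) (hL t ht.le).1
    have h2 := mul_le_mul_of_nonneg_left (hL' t ht) (hq0 t ht.le)
    have h3 := mul_le_mul_of_nonneg_left (hF' t ht) (div_pos hC ha).le
    have h4 := mul_le_mul_of_nonneg_left (hG _ (hY t ht.le) t ht.le) hC.le
    have h5 : C / a * (-a * R t) = -(C * R t) := by field_simp
    have h6 : 2 * β * (q t * Φ t) ≤ a * (q t * F t) := by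
      have h7 := mul_le_mul_of_nonneg_left (hΦle t ht.le)
        (mul_nonneg (mul_pos two_pos hβ0).le (hq0 t ht.le))
      have h8 : 2 * β * C₃ = a := by rw [hβ]; field_simp
      calc _ = 2 * β * q t * Φ t := by ring
        _ ≤ _ := h7
        _ = (2 * β * C₃) * (q t * F t) := by ring
        _ = _ := by rw [h8]
    simp only [hΦ']
    have h9 : q t * (C * G t) = C * (H (Y t) / Y t * G t) := by rw [hq]; ring
    linarith
  -- The first summand makes `C₂ * Y` a supersolution, the second orders the initial values, and the
  -- last ensures positivity.
  set C₂ := C * M / β + Φ 0 / Y 0 + 1 with hC₂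
  have hΦ0 : 0 ≤ Φ 0 := add_nonneg (mul_nonneg (hq0 0 le_rfl) (hL 0 le_rfl).1)
    (mul_nonneg (div_pos hC ha).le (hF 0 le_rfl))
  have hY0 := hY 0 le_rfl
  have hC₂0 : 0 < C₂ := by positivity
  -- Since `Y' = -β * q * Y`, the factor `1 / Y ^ 2` is the integrating factor for the rate `2 * β *
  -- q`.
  have hcont : ContinuousOn (fun t => (Φ t - C₂ * Y t) / Y t ^ 2) (Ici 0) := by
    have c1 : ContinuousOn Y (Ici 0) := fun t ht => (hYd t ht).continuousAt.continuousWithinAt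
    have c2 : ContinuousOn q (Ici 0) := fun t ht => (hqd t ht).continuousAt.continuousWithinAt
    refine ContinuousOn.div (by fun_prop) (c1.pow 2) fun t ht => (pow_pos (hY t ht) 2).ne'
  have hanti := antitoneOn_Ici_of_hasDerivAt hcont
    (fun t ht => ((hΦd t ht).sub ((hYd t ht.le).const_mul C₂)).div ((hYd t ht.le).pow 2)
      (pow_pos (hY t ht.le) 2).ne')
    (fun t ht => by
      refine div_nonpos_of_nonpos_of_nonneg ?_ (sq_nonneg _)
      have h1 := hΦ'le t ht
      have hYt := hY t ht.le
      have h2 : q t * Y t = H (Y t) := div_mul_cancel₀ _ hYt.ne'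
      have h3 : C * M ≤ C₂ * β := by
        have : C * M / β ≤ C₂ := by
          have : 0 ≤ Φ 0 / Y 0 := by positivity
          linarith
        rwa [div_le_iff₀ hβ0] at this
      have h4 := mul_le_mul_of_nonneg_right h1 hYt.le
      have h5 := mul_le_mul_of_nonneg_right h3 (mul_pos (hHY t ht.le) hYt).le
      have h6 : (Φ' t - C₂ * (-β * H (Y t))) * Y t + 2 * β * H (Y t) * (Φ t - C₂ * Y t) ≤ 0 := by
        rw [← h2] at h4 h5 ⊢
        linarith
      have h7 := mul_nonpos_of_nonneg_of_nonpos hYt.le h6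
      simp only [Nat.cast_ofNat, Nat.add_one_sub_one, pow_one, Pi.sub_apply]
      refine le_of_eq_of_le ?_ h7
      ring)
  refine ⟨a / C * C₂, β, 1, by positivity, hβ0, one_pos, fun t ht => ?_⟩
  have h1 := hanti (mem_Ici.2 le_rfl) ht ht
  have h2 : (Φ 0 - C₂ * Y 0) / Y 0 ^ 2 ≤ 0 := by
    refine div_nonpos_of_nonpos_of_nonneg ?_ (sq_nonneg _)
    have h3 : C₂ * Y 0 = C * M / β * Y 0 + Φ 0 + Y 0 := by rw [hC₂]; field_simp
    have : 0 ≤ C * M / β * Y 0 := by positivity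
    linarith
  have h3 : Φ t - C₂ * Y t ≤ 0 := by
    by_contra hcon
    exact absurd (h1.trans h2) (not_le.2 (div_pos (not_le.1 hcon) (pow_pos (hY t ht) 2)))
  have h4 : C / a * F t ≤ C₂ * Y t := by
    have := mul_nonneg (hq0 t ht) (hL t ht).1
    have h5 : Φ t = q t * L t + C / a * F t := rfl
    linarith
  have h5 := mul_le_mul_of_nonneg_left h4 (div_pos ha hC).le
  calc F t = a / C * (C / a * F t) := by field_simp
    _ ≤ _ := h5
    _ = _ := by ring

end MGT

/-! ### Extension of the data and choice of the dissipative parameter. -/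

namespace MGT

theorem hasDerivWithinAt_derivWithin_of_C1 {f : ℝ → ℝ} (hf : ContDiffOn ℝ 1 f (Ici 0)) {t : ℝ}
    (ht : 0 ≤ t) : HasDerivWithinAt f (derivWithin f (Ici 0) t) (Ici 0) t :=
  (hf.differentiableOn one_ne_zero t ht).hasDerivWithinAt

/-- The kernel extends to an admissible kernel on `ℝ` obeying the same differential inequality. -/
theorem exists_admissible_extension {g H : ℝ → ℝ} (hg_C1 : ContDiffOn ℝ 1 g (Ici 0))
    (hg_pos : ∀ t, 0 ≤ t → 0 < g t) (hg_int : IntegrableOn g (Ioi 0))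
    (hH_C1 : ContDiffOn ℝ 1 H (Ici 0)) (hH_mono : StrictMonoOn H (Ici 0)) (hH_zero : H 0 = 0)
    (hgH : ∀ t, 0 < t → deriv g t + H (g t) ≤ 0) :
    ∃ G G' : ℝ → ℝ, AdmissibleKernel G G' (∫ t in Ioi (0 : ℝ), g t) ∧
      (∀ t, 0 ≤ t → G t = g t) ∧ ∀ t, 0 ≤ t → H (G t) ≤ -G' t := by
  set g' := derivWithin g (Ici 0) with hg'
  have hg'c : ContinuousOn g' (Ici 0) :=
    hg_C1.continuousOn_derivWithin (uniqueDiffOn_Ici 0) le_rfl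
  obtain ⟨G, hGd, hGg⟩ := exists_C1_extension
    (fun t ht => hasDerivWithinAt_derivWithin_of_C1 hg_C1 ht) hg'c
  -- Continuity carries the inequality to `t = 0`, with the one-sided derivative there; the constant
  -- extension of `g'` needs its sign at that point.
  have hineq : ∀ t, 0 ≤ t → g' t + H (g t) ≤ 0 := by
    have hc : ContinuousOn (fun t => g' t + H (g t)) (closure (Ioi 0)) := by
      rw [closure_Ioi]
      exact hg'c.add (hH_C1.continuousOn.comp hg_C1.continuousOn fun t ht => (hg_pos t ht).le)
    intro t ht
    refine le_on_closure (s := Ioi 0) (g := fun _ => (0 : ℝ)) (fun s hs => ?_) hc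
      continuousOn_const (by rwa [closure_Ioi])
    rw [hg', derivWithin_of_mem_nhds (Ici_mem_nhds hs)]
    exact hgH s hs
  have hHpos : ∀ t, 0 ≤ t → 0 < H (g t) := fun t ht =>
    strictMono_pos hH_mono hH_zero (hg_pos t ht)
  have hG'le : ∀ t, g' (max t 0) ≤ 0 := fun t => by
    linarith [hineq _ (le_max_right t 0), hHpos _ (le_max_right t 0)]
  have hanti : Antitone G := antitone_of_deriv_nonpos (fun t => (hGd t).differentiableAt)
    fun t => (hGd t).deriv ▸ hG'le t
  refine ⟨G, fun t => g' (max t 0), ⟨hGd, continuous_comp_max_zero hg'c, fun t => ?_, hG'le,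
    fun t ht => ?_⟩, hGg, fun t ht => ?_⟩
  · rcases le_total 0 t with ht | ht
    · exact hGg t ht ▸ hg_pos t ht
    · exact (hGg 0 le_rfl ▸ hg_pos 0 le_rfl : 0 < G 0).trans_le (hanti ht)
  · rw [intervalIntegral.integral_congr (g := g)
      (fun s hs => hGg s (by rw [uIcc_of_le ht] at hs; exact hs.1)),
      intervalIntegral.integral_of_le ht]
    exact setIntegral_mono_set hg_int
      ((ae_restrict_iff' measurableSet_Ioi).2 (Eventually.of_forall fun s hs =>
        (hg_pos s (le_of_lt hs)).le)) Ioc_subset_Ioi_self.eventuallyLE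
  · simp only [hGg t ht, max_eq_left ht]
    linarith [hineq t ht]

variable {X : Type*} [NormedAddCommGroup X] [InnerProductSpace ℝ X] [CompleteSpace X]

theorem IsWeakSolution.exists_extension {S : X →ₗ.[ℝ] X} {τ α c b mass : ℝ} {g G G' : ℝ → ℝ}
    {u₀ u₁ : S.domain} {u₂ : X} {u v : ℝ → S.domain} {w : ℝ → X}
    (hu : IsWeakSolution S τ α c b g u₀ u₁ u₂ u v w) (hG : AdmissibleKernel G G' mass)
    (hGg : ∀ t, 0 ≤ t → G t = g t) :
    ∃ x z W U V : ℝ → X, ExtendedSolution S τ α c b G u v x z W U V ∧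
      ∀ t, 0 ≤ t → W t = w t := by
  have hvc : ContinuousOn (fun t => (v t : X)) (Ici 0) := fun t ht =>
    (hu.hasDeriv_v t ht).continuousWithinAt
  obtain ⟨x, hxd, hx⟩ := exists_C1_extension hu.hasDeriv_u hvc
  obtain ⟨z, hzd, hz⟩ := exists_C1_extension hu.hasDeriv_v hu.continuous_w
  obtain ⟨U, hUd, hU⟩ := exists_C1_extension hu.hasDeriv_Su hu.continuous_Sv
  have hUc : Continuous U := continuous_iff_continuousAt.2 fun t => (hUd t).continuousAt
  refine ⟨x, z, fun t => w (max t 0), U, fun t => S (v (max t 0)), ⟨hx, hz, hU, ?_, ?_,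
    continuous_comp_max_zero hu.continuous_w, continuous_comp_max_zero hu.continuous_Sv, ?_,
    hzd, hUd, ?_⟩, ?_⟩
  · exact fun t ht => by rw [max_eq_left ht]
  · exact continuous_iff_continuousAt.2 fun t => (hxd t).continuousAt
  · intro t ht
    have h := hxd t
    rwa [max_eq_left ht.le, ← hz t ht.le] at h
  · intro φ t ht
    have h := (hu.equation φ t ht.le).hasDerivAt (Ici_mem_nhds ht)
    have h1 : ∫ s in (0 : ℝ)..t, g (t - s) * ⟪S (u s), S φ⟫_ℝ = ⟪conv G U t, S φ⟫_ℝ := by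
      rw [← integral_conv_inner hG.continuous hUc]
      refine intervalIntegral.integral_congr fun s hs => ?_
      rw [uIcc_of_le ht.le] at hs
      rw [hGg _ (sub_nonneg.2 hs.2), hU s hs.1]
    rw [h1, ← hU t ht.le] at h
    refine (h.congr_of_eventuallyEq ?_).congr_deriv (by rw [max_eq_left ht.le])
    filter_upwards [lt_mem_nhds ht] with s hs
    rw [max_eq_left hs.le]
  · exact fun t ht => by simp only [max_eq_left ht]

theorem ExtendedSolution.energy_eq {S : X →ₗ.[ℝ] X} {τ α c b mass : ℝ} {g G G' : ℝ → ℝ}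
    {u v : ℝ → S.domain} {w x z W U V : ℝ → X}
    (hs : ExtendedSolution S τ α c b G u v x z W U V) (hG : AdmissibleKernel G G' mass)
    (hGg : ∀ t, 0 ≤ t → G t = g t) (hW : ∀ t, 0 ≤ t → W t = w t) (k : ℝ) {t : ℝ} (ht : 0 ≤ t) :
    energy S τ α c b g k u v w t = extEnergy τ α c b G k z W U V t := by
  have h1 : ∫ s in (0 : ℝ)..t, g (t - s) * ⟪S (u s), S (v t)⟫_ℝ = ⟪conv G U t, V t⟫_ℝ := by
    rw [← integral_conv_inner hG.continuous hs.continuous_U]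
    refine intervalIntegral.integral_congr fun s hs' => ?_
    rw [uIcc_of_le ht] at hs'
    rw [hGg _ (sub_nonneg.2 hs'.2), hs.eq_U s hs'.1, hs.eq_V t ht]
  have h2 : memoryQuad g (fun s => S (u s)) t = memoryQuad G U t := by
    refine intervalIntegral.integral_congr fun s hs' => ?_
    rw [uIcc_of_le ht] at hs'
    simp only
    rw [hGg _ (sub_nonneg.2 hs'.2), hs.eq_U s hs'.1, hs.eq_U t ht]
  have h3 : ∫ s in (0 : ℝ)..t, g s = ∫ s in (0 : ℝ)..t, G s := by
    refine intervalIntegral.integral_congr fun s hs' => ?_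
    rw [uIcc_of_le ht] at hs'
    exact (hGg s hs'.1).symm
  rw [energy, energy₁, energy₂, extEnergy, h1, h2, h3, ← hs.eq_U t ht, ← hs.eq_V t ht,
    ← hs.eq_v t ht, hW t ht, inner_sub_left, real_inner_smul_left]
  ring

/-- The bound on `g₀` is exactly the value of `k * (k * b - c ^ 2)` at the endpoint `k = α / τ`, so
by continuity it persists slightly to the left. -/
theorem exists_dissipative_parameter {τ α b c g₀ : ℝ} (hτ : 0 < τ) (hb : 0 < b)
    (hγ : 0 < α - c ^ 2 * τ / b) (hg₀ : g₀ < b * α * (α - c ^ 2 * τ / b) / τ ^ 2) :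
    ∃ k ∈ Ioo (c ^ 2 / b) (α / τ), g₀ < k * (k * b - c ^ 2) := by
  have hlt : c ^ 2 / b < α / τ := by
    rw [lt_div_iff₀ hτ]
    calc _ = c ^ 2 * τ / b := by ring
      _ < α := sub_pos.1 hγ
  have hval : b * α * (α - c ^ 2 * τ / b) / τ ^ 2 = α / τ * (α / τ * b - c ^ 2) := by
    field_simp
  have hc : Tendsto (fun k : ℝ => k * (k * b - c ^ 2)) (𝓝[<] (α / τ))
      (𝓝 (α / τ * (α / τ * b - c ^ 2))) :=
    (show Continuous fun k : ℝ => k * (k * b - c ^ 2) by fun_prop).continuousAt.tendsto.mono_left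
      nhdsWithin_le_nhds
  obtain ⟨k, hk, hkI⟩ :=
    ((hc.eventually (lt_mem_nhds (hval ▸ hg₀))).and (Ioo_mem_nhdsLT hlt)).exists
  exact ⟨k, hkI, hk⟩

end MGT

/-! ### Decay of the energy for every admissible parameter. -/

theorem theorem2
    {X : Type*} [NormedAddCommGroup X] [InnerProductSpace ℝ X] [CompleteSpace X]
    -- the operator `A` and its square root `S`
    (A S : X →ₗ.[ℝ] X) (hA : MGT.IsPositiveSelfAdjoint A) (hS : MGT.IsPositiveSqrt S A)
    (lam₀ : ℝ) (hlam : ∀ x : S.domain, ‖(x : X)‖ ≤ lam₀ * ‖S x‖)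
    -- the parameters, non-critical regime
    (τ α c b γ : ℝ) (hτ : 0 < τ) (hα : 0 < α) (hc : 0 < c) (hb : 0 < b)
    (hγ_def : γ = α - c ^ 2 * τ / b) (hγ : 0 < γ)
    -- the memory kernel
    (g : ℝ → ℝ) (hg_C1 : ContDiffOn ℝ 1 g (Ici 0)) (hg_pos : ∀ t, 0 ≤ t → 0 < g t)
    (hg_zero : g 0 < b * α * γ / τ ^ 2)
    (hg_int : IntegrableOn g (Ioi 0)) (hg_mass : (∫ t in Ioi (0 : ℝ), g t) < c ^ 2)
    -- the convex function controlling the kernel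
    (H : ℝ → ℝ) (hH_convex : ConvexOn ℝ (Ici 0) H) (hH_C1 : ContDiffOn ℝ 1 H (Ici 0))
    (hH_mono : StrictMonoOn H (Ici 0)) (hH_zero : H 0 = 0)
    (hgH : ∀ t, 0 < t → deriv g t + H (g t) ≤ 0)
    -- the comparison ODE
    (y : ℝ → ℝ) (hy_nonneg : ∀ t, 0 ≤ t → 0 ≤ y t) (hy_zero : y 0 = g 0)
    (hy_ode : ∀ t, 0 ≤ t → HasDerivWithinAt y (-H (y t)) (Ici 0) t)
    (α₀ : ℝ) (hα₀ : α₀ ∈ Ioo (0 : ℝ) 1)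
    (hy_int : IntegrableOn (fun t => y t ^ (1 - α₀)) (Ioi 0))
    -- behaviour of `H` near the origin
    (δ : ℝ) (hδ : 0 < δ) (hH_C2 : ContDiffOn ℝ 2 H (Ioo 0 δ))
    (hH_ineq : ∀ x ∈ Ioo 0 δ, 0 ≤ x ^ 2 * deriv (deriv H) x - x * deriv H x + H x)
    -- the weak solution, with `v = u_t` and `w = u_tt`
    (u₀ u₁ : S.domain) (u₂ : X) (u v : ℝ → S.domain) (w : ℝ → X)
    (hu : MGT.IsWeakSolution S τ α c b g u₀ u₁ u₂ u v w)
    -- the parameter of the natural energy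
    (k : ℝ) (hk : k ∈ Ioo (c ^ 2 / b) (α / τ)) :
    Tendsto (MGT.energy S τ α c b g k u v w) atTop (𝓝 0) ∧
      ∃ C β κ : ℝ, 0 < C ∧ 0 < β ∧ 0 < κ ∧
        ∀ t, 0 ≤ t → MGT.energy S τ α c b g k u v w t ≤ C * y (β * t + κ) := by
  rw [hγ_def] at hg_zero hγ
  obtain ⟨G, G', hG, hGg, hHG⟩ := MGT.exists_admissible_extension hg_C1 hg_pos hg_int hH_C1
    hH_mono hH_zero hgH
  obtain ⟨x, z, W, U, V, hs, hW⟩ := hu.exists_extension hG hGg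
  obtain ⟨k₀, hk₀, hgk₀⟩ := MGT.exists_dissipative_parameter hτ hb hγ hg_zero
  have hpos : ∀ k ∈ Ioo (c ^ 2 / b) (α / τ), 0 < k := fun k hk =>
    (div_pos (pow_pos hc 2) hb).trans hk.1
  have hGint : IntegrableOn G (Ioi 0) :=
    hg_int.congr_fun (fun t ht => (hGg t (le_of_lt ht)).symm) measurableSet_Ioi
  have hGneg : ∀ t, 0 ≤ t → G' t < 0 := fun t ht => by
    linarith [hHG t ht, MGT.strictMono_pos hH_mono hH_zero (hG.pos t)]
  obtain ⟨a, C, M, ha, hC, hF', hM, L, L', hLc, hLd, hL', hL⟩ := hs.exists_lyapunov hG hτ hα hb hc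
    hg_mass hlam hGint hGneg hk₀ (hGg 0 le_rfl ▸ hgk₀)
  set F := MGT.extEnergy τ α c b G k₀ z W U V with hF
  have hFc : Continuous F := MGT.continuous_extEnergy τ α c b k₀ hG.continuous hs.continuous_z
    hs.continuous_w hs.continuous_U hs.continuous_V
  have hFd : ∀ t, 0 < t → HasDerivAt F (deriv F t) t := fun t ht =>
    (hs.hasDerivAt_extEnergy hG k₀ ht).differentiableAt.hasDerivAt
  have hmem : ∀ t, 0 ≤ t → 0 ≤ MGT.memoryQuad G U t := fun t ht =>
    MGT.memoryQuad_nonneg U (fun t _ => (hG.pos t).le) ht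
  obtain ⟨κ₀, hκ₀, hlow⟩ := MGT.exists_mul_phaseNorm_le_extEnergy hτ hb hG hg_mass hk₀ z W V
    hs.continuous_U
  obtain ⟨κ, hκ, hlowk⟩ := MGT.exists_mul_phaseNorm_le_extEnergy hτ hb hG hg_mass hk z W V
    hs.continuous_U
  obtain ⟨κ₁, hκ₁, hup⟩ := MGT.exists_extEnergy_le_mul_phaseNorm hτ hα hb hG hg_mass (hpos k hk)
    z W V hs.continuous_U
  have hN0 : ∀ t, 0 ≤ t → 0 ≤ MGT.phaseNorm G z W U V t := fun t ht => by
    have := hmem t ht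
    rw [MGT.phaseNorm]; positivity
  have hF0 : ∀ t, 0 ≤ t → 0 ≤ F t := fun t ht =>
    (mul_nonneg hκ₀.le (hN0 t ht)).trans (hlow t ht)
  have hanti : AntitoneOn F (Ici 0) := MGT.antitoneOn_Ici_of_hasDerivAt hFc.continuousOn hFd
    fun t ht => (hF' t ht).trans (by
      rw [neg_mul, neg_nonpos]
      exact mul_nonneg ha.le (MGT.memoryQuad_nonneg U
        (fun t _ => neg_nonneg.2 (hG.deriv_nonpos t)) ht.le))
  have hUF : ∀ t, 0 ≤ t → ‖U t‖ ^ 2 ≤ κ₀⁻¹ * F t := fun t ht => by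
    rw [inv_mul_eq_div, le_div_iff₀' hκ₀]
    refine le_trans (mul_le_mul_of_nonneg_left ?_ hκ₀.le) (hlow t ht)
    have := hmem t ht
    rw [MGT.phaseNorm]
    nlinarith [sq_nonneg ‖W t‖, sq_nonneg ‖z t‖, sq_nonneg ‖V t‖]
  have hM0 : 0 ≤ M := by simpa using hM 0 le_rfl
  have hHd : ∀ x, 0 < x → HasDerivAt H (deriv H x) x := fun x hx =>
    ((hH_C1.differentiableOn one_ne_zero x hx.le).differentiableAt (Ici_mem_nhds hx)).hasDerivAt
  obtain ⟨C₂, β, η, hC₂, hβ, hη, hdecay⟩ := MGT.exists_decay_of_lyapunov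
    (M := 4 * κ₀⁻¹ * M) (G := MGT.memoryQuad G U) hH_convex hH_mono hH_zero hHd hy_nonneg
    (hy_zero ▸ hg_pos 0 le_rfl) hy_ode ha hC (by positivity) hFc hLc hFd hLd hF' hL' hF0 hL
    fun x hx t ht => by
      have h1 := MGT.div_mul_memoryQuad_le (q := fun t => -G' t) hH_convex hH_mono hH_zero
        hG.continuous hG.continuous_deriv.neg hG.pos hHG hs.continuous_U hx ht
      have h2 := mul_le_mul_of_nonneg_left (MGT.integral_norm_sub_sq_le hs.continuous_U hFc hanti
        (inv_nonneg.2 hκ₀.le) hUF hM ht) (MGT.strictMono_pos hH_mono hH_zero hx).le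
      linarith
  -- The passage from the dissipative `k₀` to the given `k`, through `phaseNorm`; the energy for `k`
  -- itself need not be monotone.
  have hEF : ∀ t, 0 ≤ t → MGT.energy S τ α c b g k u v w t ≤ κ₁ / κ₀ * F t := fun t ht => by
    rw [hs.energy_eq hG hGg hW k ht]
    refine (hup t ht).trans ?_
    rw [div_mul_eq_mul_div, le_div_iff₀ hκ₀, mul_assoc]
    exact mul_le_mul_of_nonneg_left ((mul_comm _ _).trans_le (hlow t ht)) hκ₁.le
  refine ⟨?_, κ₁ / κ₀ * C₂, β, η, by positivity, hβ, hη, fun t ht => ?_⟩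
  · have hlim : Tendsto (fun t : ℝ => κ₁ / κ₀ * (M / t)) atTop (𝓝 0) := by
      simpa using (tendsto_const_nhds.div_atTop tendsto_id).const_mul (κ₁ / κ₀)
    refine tendsto_of_tendsto_of_tendsto_of_le_of_le' tendsto_const_nhds hlim ?_ ?_
    · filter_upwards [eventually_ge_atTop 0] with t ht
      rw [hs.energy_eq hG hGg hW k ht]
      exact (mul_nonneg hκ.le (hN0 t ht)).trans (hlowk t ht)
    · filter_upwards [eventually_gt_atTop 0] with t ht
      refine (hEF t ht.le).trans (mul_le_mul_of_nonneg_left ?_ (by positivity))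
      rw [le_div_iff₀' ht]
      exact MGT.mul_le_of_antitoneOn hFc hanti hM ht.le
  · refine (hEF t ht).trans ?_
    rw [mul_assoc]
    exact mul_le_mul_of_nonneg_left (hdecay t ht) (by positivity)
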